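/- Let $(M,g)$ be a compact connected smooth Riemannian manifold (without boundary, of finite dimension), and let $d$ be its global geodesic distance, i.e. $d(x,y)$ is the infimum of the lengths of the $C^1$ curves from $x$ to $y$. For a positive integer $n$, an $n$-flag of median hyperplanes in $M$ is a collection of points $p_i, q_i\in M$ $(0\le i\le n-1)$, with $p_i\neq q_i$ for every $i$, such that $$d(z,p_s)=d(z,q_s)\qquad\text{for all } 0\le s<i\le n-1 \text{ and } z\in\{p_i,q_i\}.$$ Then $M$ does not contain $n$-flags of median hyperplanes for arbitrarily large $n$: there is an integer $N$, depending on $(M,g)$, such that every $n$-flag of median hyperplanes in $M$ satisfies $n\le N$. -/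

import Mathlib

open scoped Manifold ContDiff Bundle

/-- An `n`-flag of median hyperplanes in a metric space `X`: points `p i`, `q i` (`i : Fin n`, so the
indices are `0, …, n - 1`), with `p i` and `q i` distinct for each `i`, such that each of the points
`p i` and `q i` is equidistant from `p s` and `q s` whenever `i > s`. (It follows that all `2 n`
points are distinct.) -/
structure IsMedianFlag {X : Type*} [MetricSpace X] {n : ℕ} (p q : Fin n → X) : Prop where
  ne : ∀ i, p i ≠ q i
  equidist_left : ∀ s i, s < i → dist (p i) (p s) = dist (p i) (q s)
  equidist_right : ∀ s i, s < i → dist (q i) (p s) = dist (q i) (q s)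

/-- The metric space `X` contains an `n`-flag of median hyperplanes. -/
def ContainsMedianFlag (X : Type*) [MetricSpace X] (n : ℕ) : Prop :=
  ∃ p q : Fin n → X, IsMedianFlag p q

/-!
The squared distance `d²` of a Riemannian manifold is, near the diagonal, twice differentiable with
mixed second derivative `-2 g`. If `p`, `q` and `p'`, `q'` are close to one point `x₀` and both `p'`
and `q'` are equidistant from `p` and `q`, then the double difference
`d²(q', q) + d²(p', p) - d²(q', p) - d²(p', q)` vanishes, so that in a chart the displacements
`q - p` and `q' - p'` are almost orthogonal for the metric at `x₀`. Two pairs of a flag near `x₀`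
can therefore not have approximately the same direction, and by compactness of the unit sphere there
are finitely many approximate directions (`HasFiniteMedianCover.exists_nhds_diagonal`). Two pairs of a
flag can also not be close to the same pair `(x, y)` with `x ≠ y`
(`HasFiniteMedianCover.exists_nhds_of_ne`). As `M × M` is compact, the pairs of distinct points
are divided into finitely many classes, each containing at most one pair of any given flag.

The estimate on double differences of `d²` (`exists_nhds_doubleDifference_dist_sq_le`) is proved
without geodesics, from the description of `d²(a, b)` as the infimum of the energies
`∫ G γ (γ', γ')` over the `C¹` curves from `a` to `b` in a chart, where `G` is the metric tensor.
For short curves, the double differences of the energy are close to those of the flat energy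
`∫ G y₀ (γ', γ')` (`NearlyFlatOn.abs_energy_doubleDifference_le`). The energy is thus uniformly
convex, so that near minimizers, which exist by definition of the infimum, depend on their endpoints
in a Lipschitz way (`IsNearMinimizer.velocity_sub_le`). If `γ`, `γ₁`, `γ₂` are near minimizers from
`a` to `b`, from `a'` to `b` and from `a` to `b'`, the curve `γ₁ + γ₂ - γ` from `a'` to `b'` shows
that the double difference of `d²` is at most that of the energy
(`doubleDifference_le_of_isNearMinimizer`). Only this one-sided estimate is used.
That `d²` is the infimum of the energies, and not merely of the squared lengths, follows from
reparametrizing curves with almost constant speed (`IsC1Curve.exists_reparametrization`).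
-/

/-! ### Double differences of a metric tensor -/

section DoubleDifference

variable {E F : Type*} [NormedAddCommGroup E] [NormedSpace ℝ E]
  [NormedAddCommGroup F] [NormedSpace ℝ F]

/-- First and mixed second differences of a `C²` map are controlled near a point. -/
theorem ContDiffAt.exists_norm_doubleDifference_le {G : E → F} {y₀ : E}
    (hG : ContDiffAt ℝ 2 G y₀) :
    ∃ C > 0, ∃ r > 0, ∀ y k l : E, y ∈ Metric.ball y₀ r → y + k ∈ Metric.ball y₀ r →
      y + l ∈ Metric.ball y₀ r → y + k + l ∈ Metric.ball y₀ r →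
      ‖G (y + k) - G y‖ ≤ C * ‖k‖ ∧
      ‖G (y + k + l) - G (y + k) - G (y + l) + G y‖ ≤ C * ‖k‖ * ‖l‖ := by
  obtain ⟨C₁, t₁, ht₁, hC₁⟩ := (hG.of_le one_le_two).exists_lipschitzOnWith
  have hG' : ContDiffAt ℝ 1 (fderiv ℝ G) y₀ := hG.fderiv_right (by norm_num)
  obtain ⟨C₂, t₂, ht₂, hC₂⟩ := hG'.exists_lipschitzOnWith
  have hd : ∀ᶠ y in nhds y₀, DifferentiableAt ℝ G y :=
    (hG.eventually (by simp)).mono fun y hy => hy.differentiableAt (by simp)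
  obtain ⟨r, hr, hball⟩ := Metric.mem_nhds_iff.1 (Filter.inter_mem (Filter.inter_mem ht₁ ht₂) hd)
  have hC₁' : (C₁ : ℝ) ≤ C₁ + C₂ + 1 := by linarith [C₂.coe_nonneg]
  have hC₂' : (C₂ : ℝ) ≤ C₁ + C₂ + 1 := by linarith [C₁.coe_nonneg]
  refine ⟨C₁ + C₂ + 1, by positivity, r, hr, fun y k l hy hyk hyl hykl => ⟨?_, ?_⟩⟩
  · have := hC₁.dist_le_mul _ (hball hyk).1.1 _ (hball hy).1.1
    rw [dist_eq_norm, dist_eq_norm, add_sub_cancel_left] at this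
    exact this.trans (by gcongr)
  · -- apply the mean value inequality to `s ↦ G (s + l) - G s` on the segment `[y, y + k]`
    have hcv : Convex ℝ (segment ℝ y (y + k)) := convex_segment _ _
    have hs : ∀ s ∈ segment ℝ y (y + k), s ∈ Metric.ball y₀ r ∧ s + l ∈ Metric.ball y₀ r := by
      intro s hs
      refine ⟨(convex_ball y₀ r).segment_subset hy hyk hs, ?_⟩
      have : s + l ∈ segment ℝ (y + l) (y + k + l) := by
        obtain ⟨a, b, ha, hb, hab, rfl⟩ := hs
        refine ⟨a, b, ha, hb, hab, ?_⟩
        have : l = (a + b) • l := by rw [hab, one_smul]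
        conv_rhs => rw [this]
        module
      exact (convex_ball y₀ r).segment_subset hyl hykl this
    have key := hcv.norm_image_sub_le_of_norm_hasFDerivWithin_le
      (f := fun s => G (s + l) - G s) (f' := fun s => fderiv ℝ G (s + l) - fderiv ℝ G s)
      (C := C₂ * ‖l‖) (x := y) (y := y + k)
      (fun s hs' => by
        have h1 := (hball (hs s hs').2).2.hasFDerivAt
        have h2 := (hball (hs s hs').1).2.hasFDerivAt
        have h3 : HasFDerivAt (fun s => G (s + l)) (fderiv ℝ G (s + l)) s := by
          have := h1.comp s ((hasFDerivAt_id s).add_const l)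
          rwa [ContinuousLinearMap.comp_id] at this
        exact (h3.sub h2).hasFDerivWithinAt)
      (fun s hs' => by
        have := hC₂.dist_le_mul _ (hball (hs s hs').2).1.2 _ (hball (hs s hs').1).1.2
        rwa [dist_eq_norm, dist_eq_norm, add_sub_cancel_left] at this)
      (left_mem_segment ℝ _ _) (right_mem_segment ℝ _ _)
    rw [add_sub_cancel_left] at key
    calc ‖G (y + k + l) - G (y + k) - G (y + l) + G y‖
        = ‖G (y + k + l) - G (y + k) - (G (y + l) - G y)‖ := by congr 1; abel
      _ ≤ C₂ * ‖l‖ * ‖k‖ := key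
      _ = C₂ * ‖k‖ * ‖l‖ := by ring
      _ ≤ _ := by gcongr

/-- On the ball of radius `r` around `(y₀, 0)`, the function `(y, v) ↦ G y v v` has the same double
differences as the quadratic form `v ↦ G y₀ v v`, up to a relative error `ε`. -/
def NearlyFlatOn (G : E → E →L[ℝ] E →L[ℝ] ℝ) (y₀ : E) (r ε : ℝ) : Prop :=
  ∀ y k l v k' l' : E, y ∈ Metric.ball y₀ r → y + k ∈ Metric.ball y₀ r →
    y + l ∈ Metric.ball y₀ r → y + k + l ∈ Metric.ball y₀ r → ‖v‖ ≤ r → ‖k'‖ ≤ r → ‖l'‖ ≤ r →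
    |G (y + k + l) (v + k' + l') (v + k' + l') - G (y + k) (v + k') (v + k')
      - G (y + l) (v + l') (v + l') + G y v v - 2 * G y₀ k' l'| ≤
      ε * (‖k‖ + ‖k'‖) * (‖l‖ + ‖l'‖)

/-- Near `(y₀, 0)`, the velocities are small, so the variation of `G` contributes little: the double
difference of `(y, v) ↦ G y v v` splits into `G y₀ k' l'` terms and terms which carry a factor
`v`, `k'`, `l'` or `y - y₀` in excess. -/
theorem ContDiffAt.exists_nearlyFlatOn {G : E → E →L[ℝ] E →L[ℝ] ℝ} {y₀ : E}
    (hG : ContDiffAt ℝ 2 G y₀) (hsymm : ∀ v w, G y₀ v w = G y₀ w v) {ε : ℝ} (hε : 0 < ε) :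
    ∃ r > 0, NearlyFlatOn G y₀ r ε := by
  obtain ⟨C, hC, r₁, hr₁, H⟩ := hG.exists_norm_doubleDifference_le
  -- each error term is at most `9 C r` times a product of two norms; `20` leaves room for their sum
  set r := min (min r₁ 1) (ε / (20 * C)) with hrdef
  have hr : 0 < r := by positivity
  have hrr₁ : r ≤ r₁ := (min_le_left _ _).trans (min_le_left _ _)
  have hr1 : r ≤ 1 := (min_le_left _ _).trans (min_le_right _ _)
  have hrε : C * r * 20 ≤ ε := by
    have : r ≤ ε / (20 * C) := min_le_right _ _
    rw [le_div_iff₀ (by positivity)] at this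
    linarith
  refine ⟨r, hr, fun y k l v k' l' hy hyk hyl hykl hv hk' hl' => ?_⟩
  have sub := Metric.ball_subset_ball (x := y₀) hrr₁
  have hCk := (H y k l (sub hy) (sub hyk) (sub hyl) (sub hykl)).1
  have hCkl := (H y k l (sub hy) (sub hyk) (sub hyl) (sub hykl)).2
  have hCl := (H y l k (sub hy) (sub hyl) (sub hyk) (by rw [add_right_comm]; exact sub hykl)).1
  have hC0 : ‖G y - G y₀‖ ≤ C * r := by
    have := (H y₀ (y - y₀) 0 (Metric.mem_ball_self hr₁) (by simpa using sub hy)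
      (by simpa using hr₁) (by simpa using sub hy)).1
    rw [add_sub_cancel] at this
    refine this.trans ?_
    gcongr
    exact (mem_ball_iff_norm.1 hy).le
  have bd : ∀ {A : E →L[ℝ] E →L[ℝ] ℝ} {a x y : ℝ} {u w : E}, ‖A‖ ≤ a → ‖u‖ ≤ x → ‖w‖ ≤ y →
      |A u w| ≤ a * x * y := by
    intro A a x y u w hA hu hw
    have h := A.le_opNorm₂ u w
    rw [Real.norm_eq_abs] at h
    refine h.trans ?_
    have := (norm_nonneg A).trans hA
    have := (norm_nonneg u).trans hu
    gcongr
  have hW : ‖v + k' + l'‖ ≤ 3 * r := (norm_add₃_le).trans (by linarith)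
  have hvk : ‖v + k'‖ ≤ 2 * r := (norm_add_le _ _).trans (by linarith)
  have hvl : ‖v + l'‖ ≤ 2 * r := (norm_add_le _ _).trans (by linarith)
  have e : G (y + k + l) (v + k' + l') (v + k' + l') - G (y + k) (v + k') (v + k')
        - G (y + l) (v + l') (v + l') + G y v v - 2 * G y₀ k' l'
      = (G (y + k + l) - G (y + k) - G (y + l) + G y) (v + k' + l') (v + k' + l')
        + ((G (y + k) - G y) l' (v + k' + l') + (G (y + k) - G y) (v + k') l')
        + ((G (y + l) - G y) k' (v + k' + l') + (G (y + l) - G y) (v + l') k')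
        + ((G y - G y₀) k' l' + (G y - G y₀) l' k') := by
    have := hsymm k' l'
    simp only [sub_apply, add_apply, map_add]
    linarith
  rw [e]
  have b1 := bd hCkl hW hW
  have b2 := bd hCk le_rfl hW (u := l')
  have b3 := bd hCk hvk le_rfl (w := l')
  have b4 := bd hCl le_rfl hW (u := k')
  have b5 := bd hCl hvl le_rfl (w := k')
  have b6 := bd hC0 le_rfl le_rfl (u := k') (w := l')
  have b7 := bd hC0 le_rfl le_rfl (u := l') (w := k')
  refine (abs_add_le _ _).trans ?_
  refine (add_le_add ((abs_add_le _ _).trans (add_le_add ((abs_add_le _ _).trans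
    (add_le_add b1 ((abs_add_le _ _).trans (add_le_add b2 b3))))
    ((abs_add_le _ _).trans (add_le_add b4 b5)))) ((abs_add_le _ _).trans
    (add_le_add b6 b7))).trans ?_
  have hk0 := norm_nonneg k
  have hl0 := norm_nonneg l
  have hk0' := norm_nonneg k'
  have hl0' := norm_nonneg l'
  have hCr : 0 ≤ C * r := by positivity
  have hr2 : C * r * r * (‖k‖ * ‖l‖) ≤ C * r * (‖k‖ * ‖l‖) := by
    have : C * r * r ≤ C * r * 1 := by gcongr
    rw [mul_one] at this
    gcongr
  have h1 : 0 ≤ C * r * (‖k‖ * ‖l‖) := by positivity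
  have h2 : 0 ≤ C * r * (‖k‖ * ‖l'‖) := by positivity
  have h3 : 0 ≤ C * r * (‖k'‖ * ‖l‖) := by positivity
  have h4 : 0 ≤ C * r * (‖k'‖ * ‖l'‖) := by positivity
  calc _ = 9 * (C * r * r * (‖k‖ * ‖l‖)) + 5 * (C * r * (‖k‖ * ‖l'‖))
        + 5 * (C * r * (‖k'‖ * ‖l‖)) + 2 * (C * r * (‖k'‖ * ‖l'‖)) := by ring
    _ ≤ C * r * 20 * ((‖k‖ + ‖k'‖) * (‖l‖ + ‖l'‖)) := by
      ring_nf at hr2 h1 h2 h3 h4 ⊢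
      linarith
    _ ≤ ε * ((‖k‖ + ‖k'‖) * (‖l‖ + ‖l'‖)) := by gcongr
    _ = _ := by ring

end DoubleDifference

/-! ### Curves and their energy -/

section Energy

open Set MeasureTheory

/-- The Cauchy–Schwarz inequality for continuous functions on `[0, 1]`. -/
theorem integral_mul_le_sqrt_mul_sqrt {x y : ℝ → ℝ} (hx : ContinuousOn x (Icc 0 1))
    (hy : ContinuousOn y (Icc 0 1)) :
    ∫ t in (0 : ℝ)..1, x t * y t ≤
      √(∫ t in (0 : ℝ)..1, x t ^ 2) * √(∫ t in (0 : ℝ)..1, y t ^ 2) := by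
  have hint : ∀ {f : ℝ → ℝ}, ContinuousOn f (Icc 0 1) → IntervalIntegrable f volume 0 1 :=
    fun hf => hf.intervalIntegrable_of_Icc zero_le_one
  have hpoly : ∀ s : ℝ, 0 ≤ (∫ t in (0 : ℝ)..1, y t ^ 2) * (s * s)
      + (2 * ∫ t in (0 : ℝ)..1, x t * y t) * s + ∫ t in (0 : ℝ)..1, x t ^ 2 := by
    intro s
    have h1 : IntervalIntegrable (fun t => s ^ 2 * y t ^ 2) volume 0 1 :=
      hint (continuousOn_const.mul (hy.pow 2))
    have h2 : IntervalIntegrable (fun t => (2 * s) * (x t * y t)) volume 0 1 :=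
      hint (continuousOn_const.mul (hx.mul hy))
    have h3 : IntervalIntegrable (fun t => x t ^ 2) volume 0 1 := hint (hx.pow 2)
    have h0 : 0 ≤ ∫ t in (0 : ℝ)..1, (s ^ 2 * y t ^ 2 + (2 * s) * (x t * y t) + x t ^ 2) := by
      refine intervalIntegral.integral_nonneg zero_le_one fun t _ => ?_
      have := sq_nonneg (s * y t + x t)
      linarith
    rw [intervalIntegral.integral_add (h1.add h2) h3, intervalIntegral.integral_add h1 h2, intervalIntegral.integral_const_mul,
      intervalIntegral.integral_const_mul] at h0
    linarith
  have hd := discrim_le_zero hpoly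
  rw [discrim] at hd
  rw [← Real.sqrt_mul (intervalIntegral.integral_nonneg zero_le_one fun t _ => sq_nonneg _)]
  refine Real.le_sqrt_of_sq_le ?_
  linarith

variable {E : Type*} [NormedAddCommGroup E] [NormedSpace ℝ E]

/-- `γ` is a `C¹` curve on `[0, 1]` with velocity `v`. -/
structure IsC1Curve (γ v : ℝ → E) : Prop where
  hasDerivWithinAt : ∀ t ∈ Icc (0 : ℝ) 1, HasDerivWithinAt γ (v t) (Icc 0 1) t
  continuousOn_velocity : ContinuousOn v (Icc 0 1)

namespace IsC1Curve

variable {γ v h w : ℝ → E}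

theorem continuousOn (hγ : IsC1Curve γ v) : ContinuousOn γ (Icc 0 1) :=
  fun t ht => (hγ.hasDerivWithinAt t ht).continuousWithinAt

theorem add (hγ : IsC1Curve γ v) (hh : IsC1Curve h w) : IsC1Curve (γ + h) (v + w) :=
  ⟨fun t ht => (hγ.hasDerivWithinAt t ht).add (hh.hasDerivWithinAt t ht),
    hγ.continuousOn_velocity.add hh.continuousOn_velocity⟩

theorem sub (hγ : IsC1Curve γ v) (hh : IsC1Curve h w) : IsC1Curve (γ - h) (v - w) :=
  ⟨fun t ht => (hγ.hasDerivWithinAt t ht).sub (hh.hasDerivWithinAt t ht),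
    hγ.continuousOn_velocity.sub hh.continuousOn_velocity⟩

theorem const_smul (hγ : IsC1Curve γ v) (c : ℝ) : IsC1Curve (c • γ) (c • v) :=
  ⟨fun t ht => (hγ.hasDerivWithinAt t ht).const_smul c,
    hγ.continuousOn_velocity.const_smul c⟩

theorem neg (hγ : IsC1Curve γ v) : IsC1Curve (-γ) (-v) :=
  ⟨fun t ht => (hγ.hasDerivWithinAt t ht).neg, hγ.continuousOn_velocity.neg⟩

theorem affine (a b : E) : IsC1Curve (fun t : ℝ => a + t • b) (fun _ => b) :=
  ⟨fun t _ => by simpa using (((hasDerivAt_id t).smul_const b).const_add a).hasDerivWithinAt,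
    continuousOn_const⟩

theorem intervalIntegrable_velocity (hγ : IsC1Curve γ v) : IntervalIntegrable v volume 0 1 :=
  hγ.continuousOn_velocity.intervalIntegrable_of_Icc zero_le_one

theorem integral_velocity [CompleteSpace E] (hγ : IsC1Curve γ v) {s : ℝ} (hs : s ∈ Icc (0 : ℝ) 1) :
    ∫ t in (0 : ℝ)..s, v t = γ s - γ 0 := by
  have hsub : Icc 0 s ⊆ Icc (0 : ℝ) 1 := Icc_subset_Icc le_rfl hs.2
  refine intervalIntegral.integral_eq_sub_of_hasDeriv_right_of_le hs.1 (hγ.continuousOn.mono hsub)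
    (fun t ht => ?_) ((hγ.continuousOn_velocity.mono hsub).intervalIntegrable_of_Icc hs.1)
  have ht1 : t ∈ Ioo (0 : ℝ) 1 := ⟨ht.1, ht.2.trans_le hs.2⟩
  exact ((hγ.hasDerivWithinAt t (Ioo_subset_Icc_self ht1)).hasDerivAt
    (Icc_mem_nhds ht1.1 ht1.2)).hasDerivWithinAt

/-- The Poincaré inequality for a curve starting at the origin. -/
theorem norm_le_sqrt_integral [CompleteSpace E] (hh : IsC1Curve h w) (h0 : h 0 = 0) {s : ℝ}
    (hs : s ∈ Icc (0 : ℝ) 1) : ‖h s‖ ≤ √(∫ t in (0 : ℝ)..1, ‖w t‖ ^ 2) := by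
  have hw : ContinuousOn (fun t => ‖w t‖) (Icc 0 1) := hh.continuousOn_velocity.norm
  calc ‖h s‖ = ‖∫ t in (0 : ℝ)..s, w t‖ := by rw [hh.integral_velocity hs, h0, sub_zero]
    _ ≤ ∫ t in (0 : ℝ)..s, ‖w t‖ := intervalIntegral.norm_integral_le_integral_norm hs.1
    _ ≤ ∫ t in (0 : ℝ)..1, ‖w t‖ :=
      intervalIntegral.integral_mono_interval le_rfl hs.1 hs.2 (Filter.Eventually.of_forall fun t => norm_nonneg _)
        (hw.intervalIntegrable_of_Icc zero_le_one)
    _ = ∫ t in (0 : ℝ)..1, ‖w t‖ * 1 := by simp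
    _ ≤ √(∫ t in (0 : ℝ)..1, ‖w t‖ ^ 2) * √(∫ t in (0 : ℝ)..1, (1 : ℝ) ^ 2) :=
      integral_mul_le_sqrt_mul_sqrt hw continuousOn_const
    _ = _ := by simp

theorem integral_sq_norm_add_norm_le [CompleteSpace E] (hh : IsC1Curve h w) (h0 : h 0 = 0) :
    ∫ t in (0 : ℝ)..1, (‖h t‖ + ‖w t‖) ^ 2 ≤ 4 * ∫ t in (0 : ℝ)..1, ‖w t‖ ^ 2 := by
  set J := ∫ t in (0 : ℝ)..1, ‖w t‖ ^ 2 with hJ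
  have hJ0 : 0 ≤ J := intervalIntegral.integral_nonneg zero_le_one fun t _ => sq_nonneg _
  have hw : IntervalIntegrable (fun t => 2 * ‖w t‖ ^ 2) volume 0 1 :=
    (continuousOn_const.mul (hh.continuousOn_velocity.norm.pow 2)).intervalIntegrable_of_Icc
      zero_le_one
  calc ∫ t in (0 : ℝ)..1, (‖h t‖ + ‖w t‖) ^ 2
      ≤ ∫ t in (0 : ℝ)..1, (2 * J + 2 * ‖w t‖ ^ 2) := by
        refine intervalIntegral.integral_mono_on zero_le_one ?_ (intervalIntegrable_const.add hw) fun t ht => ?_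
        · exact ((hh.continuousOn.norm.add hh.continuousOn_velocity.norm).pow
            2).intervalIntegrable_of_Icc zero_le_one
        · have h1 := hh.norm_le_sqrt_integral h0 ht
          have h2 : ‖h t‖ ^ 2 ≤ J := by
            rw [← Real.sq_sqrt hJ0]
            gcongr
          have := sq_nonneg (‖h t‖ - ‖w t‖)
          linarith
    _ = 4 * J := by
        rw [intervalIntegral.integral_add intervalIntegrable_const hw, intervalIntegral.integral_const,
          intervalIntegral.integral_const_mul (2 : ℝ) fun t => ‖w t‖ ^ 2, ← hJ, sub_zero, one_smul]
        ring

end IsC1Curve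

/-- The energy of a curve `γ` with velocity `v` for the metric tensor `G`. -/
noncomputable def energy (G : E → E →L[ℝ] E →L[ℝ] ℝ) (γ v : ℝ → E) : ℝ :=
  ∫ t in (0 : ℝ)..1, G (γ t) (v t) (v t)

variable {G : E → E →L[ℝ] E →L[ℝ] ℝ} {y₀ : E} {r ε c : ℝ}

theorem continuousOn_energy_integrand (hG : ContinuousOn G (Metric.ball y₀ r)) {γ v : ℝ → E}
    (hγ : IsC1Curve γ v) (hγr : ∀ t ∈ Icc (0 : ℝ) 1, γ t ∈ Metric.ball y₀ r) :
    ContinuousOn (fun t => G (γ t) (v t) (v t)) (Icc 0 1) :=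
  ((hG.comp hγ.continuousOn hγr).clm_apply hγ.continuousOn_velocity).clm_apply
    hγ.continuousOn_velocity

/-- Integrated form of `NearlyFlatOn`: the energy has nearly the double differences of the flat energy
`∫ G y₀ v v`. -/
theorem NearlyFlatOn.abs_energy_doubleDifference_le (hF : NearlyFlatOn G y₀ r ε) (hε : 0 ≤ ε)
    (hG : ContinuousOn G (Metric.ball y₀ r)) {γ v K K' L L' : ℝ → E}
    (hγ : IsC1Curve γ v) (hK : IsC1Curve K K') (hL : IsC1Curve L L')
    (h00 : ∀ t ∈ Icc (0 : ℝ) 1, γ t ∈ Metric.ball y₀ r)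
    (h10 : ∀ t ∈ Icc (0 : ℝ) 1, (γ + K) t ∈ Metric.ball y₀ r)
    (h01 : ∀ t ∈ Icc (0 : ℝ) 1, (γ + L) t ∈ Metric.ball y₀ r)
    (h11 : ∀ t ∈ Icc (0 : ℝ) 1, (γ + K + L) t ∈ Metric.ball y₀ r)
    (hv : ∀ t ∈ Icc (0 : ℝ) 1, ‖v t‖ ≤ r) (hK' : ∀ t ∈ Icc (0 : ℝ) 1, ‖K' t‖ ≤ r)
    (hL' : ∀ t ∈ Icc (0 : ℝ) 1, ‖L' t‖ ≤ r) :
    |energy G (γ + K + L) (v + K' + L') - energy G (γ + K) (v + K') - energy G (γ + L) (v + L')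
      + energy G γ v - 2 * ∫ t in (0 : ℝ)..1, G y₀ (K' t) (L' t)| ≤
      ε * (√(∫ t in (0 : ℝ)..1, (‖K t‖ + ‖K' t‖) ^ 2) *
        √(∫ t in (0 : ℝ)..1, (‖L t‖ + ‖L' t‖) ^ 2)) := by
  have hint : ∀ {f : ℝ → ℝ}, ContinuousOn f (Icc 0 1) → IntervalIntegrable f volume 0 1 :=
    fun hf => hf.intervalIntegrable_of_Icc zero_le_one
  have i11 := hint (continuousOn_energy_integrand hG ((hγ.add hK).add hL) h11)
  have i10 := hint (continuousOn_energy_integrand hG (hγ.add hK) h10)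
  have i01 := hint (continuousOn_energy_integrand hG (hγ.add hL) h01)
  have i00 := hint (continuousOn_energy_integrand hG hγ h00)
  have i2 : IntervalIntegrable (fun t => 2 * G y₀ (K' t) (L' t)) volume 0 1 :=
    hint (continuousOn_const.mul ((continuousOn_const.clm_apply
      hK.continuousOn_velocity).clm_apply hL.continuousOn_velocity))
  have cK := hK.continuousOn.norm.add hK.continuousOn_velocity.norm
  have cL := hL.continuousOn.norm.add hL.continuousOn_velocity.norm
  unfold energy
  rw [← intervalIntegral.integral_const_mul, ← intervalIntegral.integral_sub i11 i10, ← intervalIntegral.integral_sub (i11.sub i10) i01,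
    ← intervalIntegral.integral_add ((i11.sub i10).sub i01) i00,
    ← intervalIntegral.integral_sub (((i11.sub i10).sub i01).add i00) i2]
  calc _ ≤ ∫ t in (0 : ℝ)..1, ε * ((‖K t‖ + ‖K' t‖) * (‖L t‖ + ‖L' t‖)) := by
        rw [← Real.norm_eq_abs]
        refine intervalIntegral.norm_integral_le_of_norm_le zero_le_one
          (Filter.Eventually.of_forall fun t ht => ?_)
          (hint (continuousOn_const.mul (cK.mul cL)))
        have ht' := Ioc_subset_Icc_self ht
        rw [Real.norm_eq_abs, ← mul_assoc]
        exact hF (γ t) (K t) (L t) (v t) (K' t) (L' t) (h00 t ht') (h10 t ht') (h01 t ht')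
          (h11 t ht') (hv t ht') (hK' t ht') (hL' t ht')
    _ ≤ _ := by
        rw [intervalIntegral.integral_const_mul]
        exact mul_le_mul_of_nonneg_left (integral_mul_le_sqrt_mul_sqrt cK cL) hε

theorem add_half_smul_mem_ball {α β : ℝ → E} (hα : ∀ t ∈ Icc (0 : ℝ) 1, α t ∈ Metric.ball y₀ r)
    (hαβ : ∀ t ∈ Icc (0 : ℝ) 1, (α + β) t ∈ Metric.ball y₀ r) :
    ∀ t ∈ Icc (0 : ℝ) 1, (α + (1 / 2 : ℝ) • β) t ∈ Metric.ball y₀ r := by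
  intro t ht
  have := (convex_ball y₀ r).midpoint_mem (hα t ht) (hαβ t ht)
  convert! this using 1
  rw [midpoint_eq_smul_add]
  simp only [Pi.add_apply, Pi.smul_apply, invOf_eq_inv]
  module

/-- A near minimizer of the energy is a near minimizer in the strong sense: the energy grows
quadratically away from it. Comparison with the midpoint `γ + h / 2` gives this without any
differentiation of the energy. -/
theorem NearlyFlatOn.energy_add_le_energy_add [CompleteSpace E] (hF : NearlyFlatOn G y₀ r ε)
    (hε : 0 ≤ ε)
    (hG : ContinuousOn G (Metric.ball y₀ r)) (hc : ∀ u, c * ‖u‖ ^ 2 ≤ G y₀ u u) (hεc : 4 * ε ≤ c)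
    {γ v h w : ℝ → E} {η : ℝ} (hγ : IsC1Curve γ v) (hh : IsC1Curve h w) (h0 : h 0 = 0)
    (hγr : ∀ t ∈ Icc (0 : ℝ) 1, γ t ∈ Metric.ball y₀ r)
    (hγhr : ∀ t ∈ Icc (0 : ℝ) 1, (γ + h) t ∈ Metric.ball y₀ r)
    (hv : ∀ t ∈ Icc (0 : ℝ) 1, ‖v t‖ ≤ r) (hw : ∀ t ∈ Icc (0 : ℝ) 1, ‖w t‖ ≤ r)
    (hmin : energy G γ v ≤ energy G (γ + (1 / 2 : ℝ) • h) (v + (1 / 2 : ℝ) • w) + η) :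
    energy G γ v + c / 4 * (∫ t in (0 : ℝ)..1, ‖w t‖ ^ 2) - 2 * η ≤ energy G (γ + h) (v + w) := by
  set J := ∫ t in (0 : ℝ)..1, ‖w t‖ ^ 2 with hJ
  have hJ0 : 0 ≤ J := intervalIntegral.integral_nonneg zero_le_one fun t _ => sq_nonneg _
  have hk := hh.const_smul (1 / 2)
  have add_two_halves : ∀ f g : ℝ → E, f + (1 / 2 : ℝ) • g + (1 / 2 : ℝ) • g = f + g := by
    intro f g
    module
  have hmid := add_half_smul_mem_ball hγr hγhr
  have hw2 : ∀ t ∈ Icc (0 : ℝ) 1, ‖((1 / 2 : ℝ) • w) t‖ ≤ r := by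
    intro t ht
    have h1 := hw t ht
    have h2 := norm_nonneg (w t)
    rw [Pi.smul_apply, norm_smul, Real.norm_of_nonneg (by norm_num)]
    linarith
  have key := hF.abs_energy_doubleDifference_le hε hG hγ hk hk hγr hmid hmid
    (by rw [add_two_halves]; exact hγhr) hv hw2 hw2
  rw [add_two_halves, add_two_halves, Real.mul_self_sqrt
    (intervalIntegral.integral_nonneg zero_le_one fun t _ => sq_nonneg _)] at key
  have hP := hk.integral_sq_norm_add_norm_le (by simp [h0])
  have e1 : ∫ t in (0 : ℝ)..1, ‖((1 / 2 : ℝ) • w) t‖ ^ 2 = J / 4 := by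
    rw [hJ, ← intervalIntegral.integral_div]
    congr 1
    ext t
    rw [Pi.smul_apply, norm_smul, Real.norm_of_nonneg (by norm_num)]
    ring
  have e2 : c * (J / 4) ≤ ∫ t in (0 : ℝ)..1, G y₀ (((1 / 2 : ℝ) • w) t) (((1 / 2 : ℝ) • w) t) := by
    rw [← e1, ← intervalIntegral.integral_const_mul]
    refine intervalIntegral.integral_mono_on zero_le_one ?_ ?_ fun t _ => hc _
    · exact (continuousOn_const.mul
        (hk.continuousOn_velocity.norm.pow 2)).intervalIntegrable_of_Icc zero_le_one
    · exact ((continuousOn_const.clm_apply hk.continuousOn_velocity).clm_apply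
        hk.continuousOn_velocity).intervalIntegrable_of_Icc zero_le_one
  rw [e1] at hP
  have h3 := (abs_le.1 key).1
  have h4 : ε * ∫ t in (0 : ℝ)..1, (‖((1 / 2 : ℝ) • h) t‖ + ‖((1 / 2 : ℝ) • w) t‖) ^ 2 ≤ ε * J := by
    gcongr
    linarith
  have h5 : ε * J ≤ c / 4 * J := by
    gcongr
    linarith
  linarith

end Energy

/-! ### Double differences of the minimal energy -/

section ValueFunction

open Set MeasureTheory

variable {E : Type*} [NormedAddCommGroup E] [NormedSpace ℝ E]

/-- `γ` is a curve from `a` to `b` with velocity `v`, both within `ρ` of `(y₀, 0)`, whose energy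
exceeds the value `f a b` by at most `η`. -/
structure IsNearMinimizer (G : E → E →L[ℝ] E →L[ℝ] ℝ) (f : E → E → ℝ) (y₀ : E) (ρ η : ℝ) (a b : E)
    (γ v : ℝ → E) : Prop where
  isC1Curve : IsC1Curve γ v
  source : γ 0 = a
  target : γ 1 = b
  mem_ball : ∀ t ∈ Icc (0 : ℝ) 1, γ t ∈ Metric.ball y₀ ρ
  norm_velocity_le : ∀ t ∈ Icc (0 : ℝ) 1, ‖v t‖ ≤ ρ
  energy_le : energy G γ v ≤ f a b + η

variable [CompleteSpace E] {G : E → E →L[ℝ] E →L[ℝ] ℝ} {f : E → E → ℝ} {y₀ : E} {r ε c ρ η κ : ℝ}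

/-- Near minimizers depend on their endpoints in a Lipschitz way, and in fact the velocity of the
difference of two of them is nearly constant: up to an error of order `ε`, the difference is the
affine curve between the differences of the endpoints. -/
theorem IsNearMinimizer.velocity_sub_le {a b a' b' : E} {γ v γ' v' : ℝ → E}
    (h : IsNearMinimizer G f y₀ ρ η a b γ v) (h' : IsNearMinimizer G f y₀ ρ η a' b' γ' v')
    (hF : NearlyFlatOn G y₀ r ε) (hε : 0 < ε) (hG : ContinuousOn G (Metric.ball y₀ r))
    (hc₀ : 0 < c) (hc : ∀ u, c * ‖u‖ ^ 2 ≤ G y₀ u u) (hεc : 10 * ε ≤ c) (hρ : 4 * ρ ≤ r)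
    (hup : ∀ γ v : ℝ → E, IsC1Curve γ v → (∀ t ∈ Icc (0 : ℝ) 1, γ t ∈ Metric.ball y₀ r) →
      f (γ 0) (γ 1) ≤ energy G γ v)
    (hκ₀ : 0 < κ) (hκρ : κ ≤ 2 * ρ) (ha : ‖a' - a‖ ≤ κ) (hb : ‖b' - b‖ ≤ κ)
    (hab : ‖(b' - b) - (a' - a)‖ ≤ κ) (hη : η ≤ ε ^ 2 * κ ^ 2 / c) :
    √(∫ t in (0 : ℝ)..1, ‖v' t - v t - ((b' - b) - (a' - a))‖ ^ 2) ≤ 10 * ε * κ / c ∧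
    √(∫ t in (0 : ℝ)..1, (‖(γ' - γ) t‖ + ‖(v' - v) t‖) ^ 2) ≤ 4 * κ := by
  set d := (b' - b) - (a' - a) with hd
  have hρ0 : 0 < ρ := by linarith
  -- `l` is the affine curve with the same endpoints as `γ' - γ`, and `k = γ' - γ - l`
  set l : ℝ → E := fun t => (a' - a) + t • d with hl
  set l' : ℝ → E := fun _ => d with hl'
  have hlC : IsC1Curve l l' := IsC1Curve.affine _ _
  have hl_le : ∀ t ∈ Icc (0 : ℝ) 1, ‖l t‖ ≤ κ := by
    intro t ht
    have e : l t = (1 - t) • (a' - a) + t • (b' - b) := by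
      simp only [hl, hd]
      module
    have := (convex_closedBall (0 : E) κ) (mem_closedBall_zero_iff.2 ha)
      (mem_closedBall_zero_iff.2 hb) (sub_nonneg.2 ht.2) ht.1 (by ring)
    rw [e]
    exact mem_closedBall_zero_iff.1 this
  set k : ℝ → E := γ' - γ - l with hk
  set k' : ℝ → E := v' - v - l' with hk'
  have hkC : IsC1Curve k k' := (h'.isC1Curve.sub h.isC1Curve).sub hlC
  have hk0 : k 0 = 0 := by
    simp [hk, hl, h.source, h'.source]
  have hk1 : k 1 = 0 := by
    simp only [hk, hl, hd, Pi.sub_apply, h.target, h'.target]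
    module
  set J := ∫ t in (0 : ℝ)..1, ‖k' t‖ ^ 2 with hJ
  have hJ0 : 0 ≤ J := intervalIntegral.integral_nonneg zero_le_one fun t _ => sq_nonneg _
  have hsub : Metric.ball y₀ ρ ⊆ Metric.ball y₀ r := Metric.ball_subset_ball (by linarith)
  have m00 : ∀ t ∈ Icc (0 : ℝ) 1, γ t ∈ Metric.ball y₀ r := fun t ht => hsub (h.mem_ball t ht)
  have m11 : ∀ t ∈ Icc (0 : ℝ) 1, γ' t ∈ Metric.ball y₀ r := fun t ht => hsub (h'.mem_ball t ht)
  have m01 : ∀ t ∈ Icc (0 : ℝ) 1, (γ + l) t ∈ Metric.ball y₀ r := by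
    intro t ht
    have h1 := mem_ball_iff_norm.1 (h.mem_ball t ht)
    have h2 := hl_le t ht
    rw [mem_ball_iff_norm]
    calc ‖(γ + l) t - y₀‖ = ‖(γ t - y₀) + l t‖ := by rw [Pi.add_apply]; congr 1; abel
      _ ≤ ‖γ t - y₀‖ + ‖l t‖ := norm_add_le _ _
      _ < r := by linarith
  have m10 : ∀ t ∈ Icc (0 : ℝ) 1, (γ + k) t ∈ Metric.ball y₀ r := by
    intro t ht
    have h1 := mem_ball_iff_norm.1 (h'.mem_ball t ht)
    have h2 := hl_le t ht
    rw [mem_ball_iff_norm]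
    calc ‖(γ + k) t - y₀‖ = ‖(γ' t - y₀) - l t‖ := by
          simp only [hk, Pi.add_apply, Pi.sub_apply]; congr 1; abel
      _ ≤ ‖γ' t - y₀‖ + ‖l t‖ := norm_sub_le _ _
      _ < r := by linarith
  have hvr : ∀ t ∈ Icc (0 : ℝ) 1, ‖v t‖ ≤ r := fun t ht => by
    linarith [h.norm_velocity_le t ht]
  have hvr' : ∀ t ∈ Icc (0 : ℝ) 1, ‖v' t‖ ≤ r := fun t ht => by
    linarith [h'.norm_velocity_le t ht]
  have hkr : ∀ t ∈ Icc (0 : ℝ) 1, ‖k' t‖ ≤ r := by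
    intro t ht
    calc ‖v' t - v t - d‖ ≤ ‖v' t‖ + ‖v t‖ + ‖d‖ :=
          (norm_sub_le _ _).trans (by gcongr; exact norm_sub_le _ _)
      _ ≤ r := by linarith [h.norm_velocity_le t ht, h'.norm_velocity_le t ht]
  have e0 : γ + k + l = γ' := by simp only [hk]; abel
  have e0' : v + k' + l' = v' := by simp only [hk']; abel
  have e1 : γ' + -k = γ + l := by simp only [hk]; abel
  have e1' : v' + -k' = v + l' := by simp only [hk']; abel
  -- quadratic growth of the energy away from `γ`, in the direction `k`
  have g1 := hF.energy_add_le_energy_add hε.le hG hc (by linarith) h.isC1Curve hkC hk0 m00 m10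
    hvr hkr (η := η) (by
      have := hup _ _ (h.isC1Curve.add (hkC.const_smul (1 / 2))) (add_half_smul_mem_ball m00 m10)
      simp only [Pi.add_apply, Pi.smul_apply, hk0, hk1, smul_zero, add_zero, h.source,
        h.target] at this
      linarith [h.energy_le])
  -- and away from `γ'`, in the direction `-k`
  have g2 := hF.energy_add_le_energy_add hε.le hG hc (by linarith) h'.isC1Curve hkC.neg
    (by simp [hk0]) m11 (by rw [e1]; exact m01) hvr' (by simpa using hkr) (η := η) (by
      have := hup _ _ (h'.isC1Curve.add (hkC.neg.const_smul (1 / 2)))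
        (add_half_smul_mem_ball m11 (by rw [e1]; exact m01))
      simp only [Pi.add_apply, Pi.smul_apply, Pi.neg_apply, hk0, hk1, smul_zero, neg_zero,
        add_zero, h'.source, h'.target] at this
      linarith [h'.energy_le])
  have g3 := hF.abs_energy_doubleDifference_le hε.le hG h.isC1Curve hkC hlC m00 m10 m01
    (by rw [e0]; exact m11) hvr hkr (fun t _ => by linarith)
  rw [e1, e1'] at g2
  rw [e0, e0'] at g3
  -- `k` vanishes at both ends, so its velocity is orthogonal to the constant velocity of `l`
  have z : ∫ t in (0 : ℝ)..1, G y₀ (k' t) (l' t) = 0 := by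
    have h1 : ∫ t in (0 : ℝ)..1, k' t = 0 := by
      rw [hkC.integral_velocity (right_mem_Icc.2 zero_le_one), hk0, hk1, sub_zero]
    have h2 := ((G y₀).flip d).intervalIntegral_comp_comm hkC.intervalIntegrable_velocity
    simp only [ContinuousLinearMap.flip_apply] at h2
    rw [h2, h1]
    simp
  have J' : ∫ t in (0 : ℝ)..1, ‖(-k') t‖ ^ 2 = J := by simp [hJ]
  rw [J'] at g2
  rw [z] at g3
  have hkk := hkC.integral_sq_norm_add_norm_le hk0
  have sk : √(∫ t in (0 : ℝ)..1, (‖k t‖ + ‖k' t‖) ^ 2) ≤ 2 * √J := by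
    rw [Real.sqrt_le_left (by positivity), mul_pow, Real.sq_sqrt hJ0]
    linarith
  have sl : √(∫ t in (0 : ℝ)..1, (‖l t‖ + ‖l' t‖) ^ 2) ≤ 2 * κ := by
    rw [Real.sqrt_le_left (by positivity)]
    calc ∫ t in (0 : ℝ)..1, (‖l t‖ + ‖l' t‖) ^ 2 ≤ ∫ t in (0 : ℝ)..1, (2 * κ) ^ 2 := by
          refine intervalIntegral.integral_mono_on zero_le_one ?_ intervalIntegrable_const
            fun t ht => ?_
          · exact ((hlC.continuousOn.norm.add hlC.continuousOn_velocity.norm).pow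
              2).intervalIntegrable_of_Icc zero_le_one
          · have := hl_le t ht
            have h2 : ‖l' t‖ ≤ κ := hab
            gcongr
            linarith
      _ = _ := by simp
  have g4 : c / 2 * J - 4 * η ≤ 4 * ε * κ * √J := by
    have : ε * (√(∫ t in (0 : ℝ)..1, (‖k t‖ + ‖k' t‖) ^ 2) *
        √(∫ t in (0 : ℝ)..1, (‖l t‖ + ‖l' t‖) ^ 2)) ≤ ε * ((2 * √J) * (2 * κ)) := by
      gcongr
    linarith [(abs_le.1 g3).1]
  have hs : √J ≤ 10 * ε * κ / c := by
    by_contra! hlt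
    set s := √J with hs
    have hs2 : J = s ^ 2 := (Real.sq_sqrt hJ0).symm
    -- in terms of `x = ε κ / c`, the quadratic inequality `g4` fails for `√J > 10 x`
    set x := ε * κ / c with hx
    have hx0 : 0 < x := by positivity
    have hxs : 10 * x < s := by
      rw [hx]
      calc 10 * (ε * κ / c) = 10 * ε * κ / c := by ring
        _ < s := hlt
    have e2 : ε ^ 2 * κ ^ 2 / c = c * x ^ 2 := by rw [hx]; field_simp
    have e3 : ε * κ = c * x := by rw [hx]; field_simp
    rw [e2] at hη
    rw [hs2, show 4 * ε * κ * s = 4 * (ε * κ) * s by ring, e3] at g4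
    have g5 : c * (s ^ 2 / 2 - 4 * x ^ 2 - 4 * x * s) ≤ 0 := by linarith
    have g6 : 0 < s ^ 2 / 2 - 4 * x ^ 2 - 4 * x * s := by nlinarith
    have := mul_pos hc₀ g6
    linarith
  refine ⟨hs, ?_⟩
  have hsκ : √J ≤ κ := by
    refine hs.trans ?_
    rw [div_le_iff₀ hc₀]
    nlinarith
  have hJκ : J ≤ κ ^ 2 := by
    rw [← Real.sq_sqrt hJ0]
    gcongr
  rw [Real.sqrt_le_left (by positivity)]
  have hi : IntervalIntegrable (fun t => 2 * (‖k t‖ + ‖k' t‖) ^ 2) volume 0 1 :=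
    (continuousOn_const.mul ((hkC.continuousOn.norm.add
      hkC.continuousOn_velocity.norm).pow 2)).intervalIntegrable_of_Icc zero_le_one
  have hKC := h'.isC1Curve.sub h.isC1Curve
  calc ∫ t in (0 : ℝ)..1, (‖(γ' - γ) t‖ + ‖(v' - v) t‖) ^ 2
      ≤ ∫ t in (0 : ℝ)..1, (8 * κ ^ 2 + 2 * (‖k t‖ + ‖k' t‖) ^ 2) := by
        refine intervalIntegral.integral_mono_on zero_le_one ?_
          (intervalIntegrable_const.add hi) fun t ht => ?_
        · exact ((hKC.continuousOn.norm.add hKC.continuousOn_velocity.norm).pow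
            2).intervalIntegrable_of_Icc zero_le_one
        · have h1 : ‖(γ' - γ) t‖ ≤ κ + ‖k t‖ := by
            have : (γ' - γ) t = l t + k t := by simp [hk]
            rw [this]
            exact (norm_add_le _ _).trans (by gcongr; exact hl_le t ht)
          have h2 : ‖(v' - v) t‖ ≤ κ + ‖k' t‖ := by
            have : (v' - v) t = d + k' t := by simp [hk', hl']
            rw [this]
            exact (norm_add_le _ _).trans (by gcongr)
          have h3 : (‖(γ' - γ) t‖ + ‖(v' - v) t‖) ^ 2 ≤ (2 * κ + (‖k t‖ + ‖k' t‖)) ^ 2 :=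
            pow_le_pow_left₀ (by positivity) (by linarith) 2
          linarith [sq_nonneg (2 * κ - (‖k t‖ + ‖k' t‖))]
    _ = 8 * κ ^ 2 + 2 * ∫ t in (0 : ℝ)..1, (‖k t‖ + ‖k' t‖) ^ 2 := by
        rw [intervalIntegral.integral_add intervalIntegrable_const hi,
          intervalIntegral.integral_const, sub_zero, one_smul,
          intervalIntegral.integral_const_mul]
    _ ≤ (4 * κ) ^ 2 := by linarith

/-- With `γ`, `γ₁`, `γ₂` nearly minimizing from `a` to `b`, from `a'` to `b` and from `a` to `b'`, the
curve `γ₁ + γ₂ - γ` joins `a'` to `b'`; comparison with its energy bounds `f a' b'`, and thereby the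
double difference of `f`, by a double difference of the energy. -/
theorem doubleDifference_le_of_isNearMinimizer {a b a' b' : E}
    {γ v γ₁ v₁ γ₂ v₂ : ℝ → E} (ha : a' ≠ a) (hb : b' ≠ b)
    (h : IsNearMinimizer G f y₀ ρ η a b γ v) (h₁ : IsNearMinimizer G f y₀ ρ η a' b γ₁ v₁)
    (h₂ : IsNearMinimizer G f y₀ ρ η a b' γ₂ v₂)
    (hF : NearlyFlatOn G y₀ r ε) (hε : 0 < ε) (hG : ContinuousOn G (Metric.ball y₀ r))
    (hc₀ : 0 < c) (hc : ∀ u, c * ‖u‖ ^ 2 ≤ G y₀ u u) (hεc : 10 * ε ≤ c) (hρ : 4 * ρ ≤ r)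
    (hup : ∀ γ v : ℝ → E, IsC1Curve γ v → (∀ t ∈ Icc (0 : ℝ) 1, γ t ∈ Metric.ball y₀ r) →
      f (γ 0) (γ 1) ≤ energy G γ v)
    (haρ : ‖a' - a‖ ≤ 2 * ρ) (hbρ : ‖b' - b‖ ≤ 2 * ρ) (hηa : η ≤ ε ^ 2 * ‖a' - a‖ ^ 2 / c)
    (hηb : η ≤ ε ^ 2 * ‖b' - b‖ ^ 2 / c) (hηab : η ≤ ε * (‖a' - a‖ * ‖b' - b‖)) :
    f a' b' + f a b - f a' b - f a b' ≤ -2 * G y₀ (a' - a) (b' - b)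
      + (200 * ‖G y₀‖ * ε ^ 2 / c ^ 2 + 18 * ε) * (‖a' - a‖ * ‖b' - b‖) := by
  have ha0 : 0 < ‖a' - a‖ := norm_pos_iff.2 (sub_ne_zero.2 ha)
  have hb0 : 0 < ‖b' - b‖ := norm_pos_iff.2 (sub_ne_zero.2 hb)
  have hρ0 : 0 < ρ := by linarith
  obtain ⟨A1, A2⟩ := h.velocity_sub_le h₁ hF hε hG hc₀ hc hεc hρ hup ha0 haρ le_rfl
    (by simp) (by simp [norm_sub_rev]) hηa
  obtain ⟨B1, B2⟩ := h.velocity_sub_le h₂ hF hε hG hc₀ hc hεc hρ hup hb0 hbρ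
    (by simp) le_rfl (by simp) hηb
  simp only [sub_self, zero_sub, sub_zero, sub_neg_eq_add] at A1 B1
  have hK := h₁.isC1Curve.sub h.isC1Curve
  have hL := h₂.isC1Curve.sub h.isC1Curve
  have hsub : Metric.ball y₀ ρ ⊆ Metric.ball y₀ r := Metric.ball_subset_ball (by linarith)
  have m11 : ∀ t ∈ Icc (0 : ℝ) 1, (γ + (γ₁ - γ) + (γ₂ - γ)) t ∈ Metric.ball y₀ r := by
    intro t ht
    have n0 := mem_ball_iff_norm.1 (h.mem_ball t ht)
    have n1 := mem_ball_iff_norm.1 (h₁.mem_ball t ht)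
    have n2 := mem_ball_iff_norm.1 (h₂.mem_ball t ht)
    rw [mem_ball_iff_norm]
    calc ‖(γ + (γ₁ - γ) + (γ₂ - γ)) t - y₀‖ = ‖(γ₁ t - y₀) + (γ₂ t - y₀) - (γ t - y₀)‖ := by
          simp only [Pi.add_apply, Pi.sub_apply]; congr 1; abel
      _ ≤ ‖γ₁ t - y₀‖ + ‖γ₂ t - y₀‖ + ‖γ t - y₀‖ :=
          (norm_sub_le _ _).trans (by gcongr; exact norm_add_le _ _)
      _ < r := by linarith
  have hvr : ∀ t ∈ Icc (0 : ℝ) 1, ‖v t‖ ≤ r := fun t ht => by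
    linarith [h.norm_velocity_le t ht]
  have key := hF.abs_energy_doubleDifference_le hε.le hG h.isC1Curve hK hL
    (fun t ht => hsub (h.mem_ball t ht))
    (by rw [add_sub_cancel]; exact fun t ht => hsub (h₁.mem_ball t ht))
    (by rw [add_sub_cancel]; exact fun t ht => hsub (h₂.mem_ball t ht)) m11 hvr
    (fun t ht => (norm_sub_le _ _).trans (by
      linarith [h.norm_velocity_le t ht, h₁.norm_velocity_le t ht]))
    (fun t ht => (norm_sub_le _ _).trans (by
      linarith [h.norm_velocity_le t ht, h₂.norm_velocity_le t ht]))
  have hcomp := hup _ _ ((h.isC1Curve.add hK).add hL) m11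
  have h00 := hup _ _ h.isC1Curve (fun t ht => hsub (h.mem_ball t ht))
  rw [add_sub_cancel, add_sub_cancel, add_sub_cancel, add_sub_cancel] at key
  rw [add_sub_cancel, add_sub_cancel] at hcomp
  have s0 : (γ₁ + (γ₂ - γ)) 0 = a' := by simp [h.source, h₁.source, h₂.source]
  have s1 : (γ₁ + (γ₂ - γ)) 1 = b' := by simp [h.target, h₁.target, h₂.target]
  rw [s0, s1] at hcomp
  rw [h.source, h.target] at h00
  have err : ε * (√(∫ t in (0 : ℝ)..1, (‖(γ₁ - γ) t‖ + ‖(v₁ - v) t‖) ^ 2) *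
      √(∫ t in (0 : ℝ)..1, (‖(γ₂ - γ) t‖ + ‖(v₂ - v) t‖) ^ 2)) ≤
      ε * ((4 * ‖a' - a‖) * (4 * ‖b' - b‖)) := by
    gcongr
  -- the mixed term: the velocities of `γ₁ - γ` and `γ₂ - γ` are nearly `-(a' - a)` and `b' - b`
  have mixed : ∫ t in (0 : ℝ)..1, G y₀ ((v₁ - v) t) ((v₂ - v) t) ≤ -G y₀ (a' - a) (b' - b) +
      ‖G y₀‖ * ((10 * ε * ‖a' - a‖ / c) * (10 * ε * ‖b' - b‖ / c)) := by
    have c1 : ContinuousOn (fun t => (v₁ - v) t + (a' - a)) (Icc 0 1) :=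
      hK.continuousOn_velocity.add continuousOn_const
    have c2 : ContinuousOn (fun t => (v₂ - v) t - (b' - b)) (Icc 0 1) :=
      hL.continuousOn_velocity.sub continuousOn_const
    have i1 : ∫ t in (0 : ℝ)..1, (v₁ - v) t = -(a' - a) := by
      rw [hK.integral_velocity (right_mem_Icc.2 zero_le_one)]
      simp [h.source, h₁.source, h.target, h₁.target]
    have i2 : ∫ t in (0 : ℝ)..1, (v₂ - v) t = b' - b := by
      rw [hL.integral_velocity (right_mem_Icc.2 zero_le_one)]
      simp [h.source, h₂.source, h.target, h₂.target]
    have l1 := ((G y₀).flip (b' - b)).intervalIntegral_comp_comm hK.intervalIntegrable_velocity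
    have l2 := (G y₀ (a' - a)).intervalIntegral_comp_comm hL.intervalIntegrable_velocity
    simp only [ContinuousLinearMap.flip_apply] at l1
    rw [i1] at l1
    rw [i2] at l2
    have hint : ∀ {f : ℝ → ℝ}, ContinuousOn f (Icc 0 1) → IntervalIntegrable f volume 0 1 :=
      fun hf => hf.intervalIntegrable_of_Icc zero_le_one
    have j0 : IntervalIntegrable (fun t => G y₀ ((v₁ - v) t + (a' - a))
        ((v₂ - v) t - (b' - b))) volume 0 1 :=
      hint ((continuousOn_const.clm_apply c1).clm_apply c2)
    have j1 : IntervalIntegrable (fun t => G y₀ ((v₁ - v) t) (b' - b)) volume 0 1 :=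
      hint ((continuousOn_const.clm_apply hK.continuousOn_velocity).clm_apply continuousOn_const)
    have j2 : IntervalIntegrable (fun t => G y₀ (a' - a) ((v₂ - v) t)) volume 0 1 :=
      hint (continuousOn_const.clm_apply hL.continuousOn_velocity)
    have split : ∫ t in (0 : ℝ)..1, G y₀ ((v₁ - v) t) ((v₂ - v) t) =
        (∫ t in (0 : ℝ)..1, G y₀ ((v₁ - v) t + (a' - a)) ((v₂ - v) t - (b' - b)))
          - G y₀ (a' - a) (b' - b) := by
      have : ∀ t, G y₀ ((v₁ - v) t) ((v₂ - v) t) =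
          G y₀ ((v₁ - v) t + (a' - a)) ((v₂ - v) t - (b' - b)) + G y₀ ((v₁ - v) t) (b' - b)
            - G y₀ (a' - a) ((v₂ - v) t) + G y₀ (a' - a) (b' - b) := by
        intro t
        simp only [map_add, map_sub, add_apply]
        ring
      simp only [this]
      rw [intervalIntegral.integral_add ((j0.add j1).sub j2) intervalIntegrable_const,
        intervalIntegral.integral_sub (j0.add j1) j2, intervalIntegral.integral_add j0 j1, l1, l2,
        intervalIntegral.integral_const, map_neg, neg_apply, sub_zero, one_smul]
      ring
    have bound : ∫ t in (0 : ℝ)..1, G y₀ ((v₁ - v) t + (a' - a)) ((v₂ - v) t - (b' - b)) ≤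
        ‖G y₀‖ * ((10 * ε * ‖a' - a‖ / c) * (10 * ε * ‖b' - b‖ / c)) := by
      calc _ ≤ ∫ t in (0 : ℝ)..1,
            ‖G y₀‖ * (‖(v₁ - v) t + (a' - a)‖ * ‖(v₂ - v) t - (b' - b)‖) := by
            refine intervalIntegral.integral_mono_on zero_le_one j0
              (hint (continuousOn_const.mul (c1.norm.mul c2.norm))) fun t _ => ?_
            rw [← mul_assoc]
            exact (le_abs_self _).trans ((G y₀).le_opNorm₂ _ _)
        _ ≤ _ := by
            rw [intervalIntegral.integral_const_mul]
            refine mul_le_mul_of_nonneg_left ?_ (norm_nonneg (G y₀))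
            refine (integral_mul_le_sqrt_mul_sqrt c1.norm c2.norm).trans ?_
            exact mul_le_mul A1 B1 (Real.sqrt_nonneg _) (by positivity)
    linarith
  have e : (200 * ‖G y₀‖ * ε ^ 2 / c ^ 2 + 18 * ε) * (‖a' - a‖ * ‖b' - b‖) =
      2 * (‖G y₀‖ * ((10 * ε * ‖a' - a‖ / c) * (10 * ε * ‖b' - b‖ / c)))
      + ε * ((4 * ‖a' - a‖) * (4 * ‖b' - b‖)) + 2 * (ε * (‖a' - a‖ * ‖b' - b‖)) := by
    field_simp
    ring
  rw [e]
  linarith [(abs_le.1 key).2, h₁.energy_le, h₂.energy_le]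

/-- If `f a b` is the infimum of the energies of the curves from `a` to `b`, then its mixed second
derivative at `(y₀, y₀)` is `-2 G y₀`, in the sense of double differences. -/
theorem exists_ball_doubleDifference_le (hG : ContDiffAt ℝ 2 G y₀)
    (hsymm : ∀ v w, G y₀ v w = G y₀ w v) (hc₀ : 0 < c) (hc : ∀ u, c * ‖u‖ ^ 2 ≤ G y₀ u u)
    (hup : ∃ r > 0, ∀ γ v : ℝ → E, IsC1Curve γ v →
      (∀ t ∈ Icc (0 : ℝ) 1, γ t ∈ Metric.ball y₀ r) → f (γ 0) (γ 1) ≤ energy G γ v)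
    (hlow : ∀ ρ > 0, ∃ δ > 0, ∀ a ∈ Metric.ball y₀ δ, ∀ b ∈ Metric.ball y₀ δ, ∀ η > 0,
      ∃ γ v : ℝ → E, IsNearMinimizer G f y₀ ρ η a b γ v) {ε : ℝ} (hε : 0 < ε) :
    ∃ δ > 0, ∀ a ∈ Metric.ball y₀ δ, ∀ b ∈ Metric.ball y₀ δ, ∀ a' ∈ Metric.ball y₀ δ,
      ∀ b' ∈ Metric.ball y₀ δ, f a' b' + f a b - f a' b - f a b' ≤
        -2 * G y₀ (a' - a) (b' - b) + ε * (‖a' - a‖ * ‖b' - b‖) := by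
  -- `10 ε₁ ≤ c` makes the error `200 ‖G y₀‖ ε₁ ^ 2 / c ^ 2` linear in `ε₁`
  set ε₁ := min (c / 10) (ε / (20 * ‖G y₀‖ / c + 18)) with hε₁
  have hε₁0 : 0 < ε₁ := by positivity
  have hε₁c : 10 * ε₁ ≤ c := by
    have : ε₁ ≤ c / 10 := min_le_left _ _
    linarith
  have hε₁ε : 200 * ‖G y₀‖ * ε₁ ^ 2 / c ^ 2 + 18 * ε₁ ≤ ε := by
    have h1 : ε₁ ≤ ε / (20 * ‖G y₀‖ / c + 18) := min_le_right _ _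
    rw [le_div_iff₀ (by positivity)] at h1
    refine le_trans ?_ h1
    have : 200 * ‖G y₀‖ * ε₁ ^ 2 / c ^ 2 = ε₁ * (20 * ‖G y₀‖ / c) * (10 * ε₁ / c) := by
      field_simp
      ring
    rw [this]
    have h2 : 10 * ε₁ / c ≤ 1 := (div_le_one hc₀).2 hε₁c
    have h3 : ε₁ * (20 * ‖G y₀‖ / c) * (10 * ε₁ / c) ≤ ε₁ * (20 * ‖G y₀‖ / c) * 1 := by gcongr
    linarith
  obtain ⟨r₁, hr₁, hF⟩ := hG.exists_nearlyFlatOn hsymm hε₁0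
  obtain ⟨r₂, hr₂, hup⟩ := hup
  obtain ⟨r₃, hr₃, hcont⟩ : ∃ r > 0, ContinuousOn G (Metric.ball y₀ r) := by
    obtain ⟨r, hr, h⟩ := Metric.mem_nhds_iff.1 (hG.eventually (by simp))
    refine ⟨r, hr, fun y hy => ?_⟩
    have hy' : ContDiffAt ℝ 2 G y := h hy
    exact hy'.continuousAt.continuousWithinAt
  set r := min (min r₁ r₂) r₃ with hr
  have hr0 : 0 < r := by positivity
  have hrr₁ : r ≤ r₁ := (min_le_left _ _).trans (min_le_left _ _)
  have hrr₂ : r ≤ r₂ := (min_le_left _ _).trans (min_le_right _ _)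
  have hrr₃ : r ≤ r₃ := min_le_right _ _
  have hF' : NearlyFlatOn G y₀ r ε₁ := fun y k l v k' l' h1 h2 h3 h4 h5 h6 h7 =>
    hF y k l v k' l' (Metric.ball_subset_ball hrr₁ h1) (Metric.ball_subset_ball hrr₁ h2)
      (Metric.ball_subset_ball hrr₁ h3) (Metric.ball_subset_ball hrr₁ h4) (h5.trans hrr₁)
      (h6.trans hrr₁) (h7.trans hrr₁)
  obtain ⟨δ, hδ, hlow⟩ := hlow (r / 4) (by positivity)
  refine ⟨min δ (r / 4), by positivity, fun a ha b hb a' ha' b' hb' => ?_⟩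
  by_cases hab : a' = a ∨ b' = b
  · rcases hab with rfl | rfl <;> simp
  push Not at hab
  obtain ⟨haa, hbb⟩ := hab
  have ha0 : 0 < ‖a' - a‖ := norm_pos_iff.2 (sub_ne_zero.2 haa)
  have hb0 : 0 < ‖b' - b‖ := norm_pos_iff.2 (sub_ne_zero.2 hbb)
  have dist2 : ∀ x ∈ Metric.ball y₀ (min δ (r / 4)), ∀ y ∈ Metric.ball y₀ (min δ (r / 4)),
      ‖x - y‖ ≤ 2 * (r / 4) := by
    intro x hx y hy
    have h1 := (mem_ball_iff_norm.1 hx).trans_le (min_le_right _ _)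
    have h2 := (mem_ball_iff_norm.1 hy).trans_le (min_le_right _ _)
    calc ‖x - y‖ = ‖(x - y₀) - (y - y₀)‖ := by rw [sub_sub_sub_cancel_right]
      _ ≤ ‖x - y₀‖ + ‖y - y₀‖ := norm_sub_le _ _
      _ ≤ _ := by linarith
  have hsub : Metric.ball y₀ (min δ (r / 4)) ⊆ Metric.ball y₀ δ :=
    Metric.ball_subset_ball (min_le_left _ _)
  -- the tolerance of the near minimizers is chosen after the four points, and negligible for them
  set η := min (min (ε₁ ^ 2 * ‖a' - a‖ ^ 2 / c) (ε₁ ^ 2 * ‖b' - b‖ ^ 2 / c))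
    (ε₁ * (‖a' - a‖ * ‖b' - b‖)) with hη
  have hη0 : 0 < η := by positivity
  obtain ⟨γ, v, h⟩ := hlow a (hsub ha) b (hsub hb) η hη0
  obtain ⟨γ₁, v₁, h₁⟩ := hlow a' (hsub ha') b (hsub hb) η hη0
  obtain ⟨γ₂, v₂, h₂⟩ := hlow a (hsub ha) b' (hsub hb') η hη0
  refine (doubleDifference_le_of_isNearMinimizer haa hbb h h₁ h₂ hF' hε₁0
    (hcont.mono (Metric.ball_subset_ball hrr₃)) hc₀ hc hε₁c (by linarith)
    (fun γ v hγ hγr => hup γ v hγ fun t ht => Metric.ball_subset_ball hrr₂ (hγr t ht))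
    (dist2 _ ha' _ ha) (dist2 _ hb' _ hb) ((min_le_left _ _).trans (min_le_left _ _))
    ((min_le_left _ _).trans (min_le_right _ _)) (min_le_right _ _)).trans ?_
  gcongr

end ValueFunction

/-! ### Length and reparametrization -/

section Reparametrization

open Set MeasureTheory Filter

/-- A parameter change of `[0, 1]` along which a nonnegative speed `w` becomes at most its integral
plus `η`. Adding `η` to `w` makes the rescaled arc length invertible where `w` vanishes. -/
theorem exists_reparametrization_mul_le {w : ℝ → ℝ} (hw : ContinuousOn w (Icc 0 1))
    (hw₀ : ∀ t ∈ Icc (0 : ℝ) 1, 0 ≤ w t) {η : ℝ} (hη : 0 < η) :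
    ∃ σ σ' : ℝ → ℝ, IsC1Curve σ σ' ∧ σ 0 = 0 ∧ σ 1 = 1 ∧ MapsTo σ (Icc 0 1) (Icc 0 1) ∧
      ∀ t ∈ Icc (0 : ℝ) 1, 0 ≤ σ' t ∧ σ' t * w (σ t) ≤ (∫ t in (0 : ℝ)..1, w t) + η := by
  set u : ℝ → ℝ := fun t => w (projIcc 0 1 zero_le_one t) + η with hu
  have hp : ∀ t, ((projIcc 0 1 zero_le_one t : Icc (0 : ℝ) 1) : ℝ) ∈ Icc (0 : ℝ) 1 :=
    fun t => (projIcc 0 1 zero_le_one t).2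
  have huc : Continuous u :=
    (hw.comp_continuous (continuous_subtype_val.comp continuous_projIcc) hp).add continuous_const
  have huη : ∀ t, η ≤ u t := fun t => by
    have := hw₀ _ (hp t)
    simp only [hu]
    linarith
  have hu0 : ∀ t, 0 < u t := fun t => hη.trans_le (huη t)
  have huI : ∀ t ∈ Icc (0 : ℝ) 1, u t = w t + η := fun t ht => by
    simp only [hu, projIcc_of_mem zero_le_one ht]
  have hW : ∫ t in (0 : ℝ)..1, u t = (∫ t in (0 : ℝ)..1, w t) + η := by
    rw [intervalIntegral.integral_congr (g := fun t => w t + η)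
      (fun t ht => huI t (by rwa [uIcc_of_le zero_le_one] at ht)),
      intervalIntegral.integral_add (hw.intervalIntegrable_of_Icc zero_le_one)
        intervalIntegrable_const, intervalIntegral.integral_const, sub_zero, one_smul]
  set W := ∫ t in (0 : ℝ)..1, u t with hWdef
  have hW0 : 0 < W := by
    have := intervalIntegral.integral_nonneg (μ := volume) zero_le_one hw₀
    linarith
  set s : ℝ → ℝ := fun t => (∫ x in (0 : ℝ)..t, u x) / W with hs
  have hsd : ∀ t, HasDerivAt s (u t / W) t := fun t =>
    (huc.integral_hasStrictDerivAt 0 t).hasDerivAt.div_const W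
  have hmono : StrictMono s :=
    strictMono_of_hasDerivAt_pos hsd fun t => div_pos (hu0 t) hW0
  have hscont : Continuous s := continuous_iff_continuousAt.2 fun t => (hsd t).continuousAt
  have hs0 : s 0 = 0 := by simp [hs]
  have hs1 : s 1 = 1 := by
    simp only [hs]
    exact div_self hW0.ne'
  have hlin : Monotone fun t => s t - η / W * t := by
    have hd : ∀ t, HasDerivAt (fun t => s t - η / W * t) (u t / W - η / W) t := fun t => by
      have := (hsd t).sub ((hasDerivAt_id t).const_mul (η / W))
      rwa [mul_one] at this
    refine monotone_of_deriv_nonneg (fun t => (hd t).differentiableAt) fun t => ?_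
    rw [(hd t).deriv, ← sub_div]
    exact div_nonneg (sub_nonneg.2 (huη t)) hW0.le
  have hpos : 0 < η / W := div_pos hη hW0
  have htop : Tendsto s atTop atTop := by
    refine tendsto_atTop_mono' _ ?_ (tendsto_id.const_mul_atTop hpos)
    filter_upwards [eventually_ge_atTop 0] with t ht
    have := hlin ht
    simp only [hs0, mul_zero, sub_zero] at this
    simpa using this
  have hbot : Tendsto s atBot atBot := by
    refine tendsto_atBot_mono' _ ?_ (tendsto_id.const_mul_atBot hpos)
    filter_upwards [eventually_le_atBot 0] with t ht
    have := hlin ht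
    simp only [hs0, mul_zero, sub_zero] at this
    simpa using this
  let e := hmono.orderIsoOfSurjective s (hscont.surjective htop hbot)
  have he : ∀ t, s (e.symm t) = t := e.apply_symm_apply
  have he' : ∀ t, e.symm (s t) = t := e.symm_apply_apply
  have hσc : Continuous e.symm := e.symm.continuous
  -- the parameter change is the inverse of the rescaled arc length `s`
  have hσd : ∀ t, HasDerivAt e.symm (u (e.symm t) / W)⁻¹ t := fun t =>
    HasDerivAt.of_local_left_inverse hσc.continuousAt (hsd _)
      (div_pos (hu0 _) hW0).ne' (Eventually.of_forall he)
  have h0 : e.symm 0 = 0 := by rw [← hs0, he', hs0]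
  have h1 : e.symm 1 = 1 := by rw [← hs1, he', hs1]
  have hmaps : MapsTo e.symm (Icc 0 1) (Icc 0 1) := fun t ht => by
    constructor
    · rw [← h0]; exact e.symm.monotone ht.1
    · rw [← h1]; exact e.symm.monotone ht.2
  refine ⟨e.symm, fun t => (u (e.symm t) / W)⁻¹, ⟨fun t _ => (hσd t).hasDerivWithinAt, ?_⟩,
    h0, h1, hmaps, fun t ht => ⟨(inv_pos.2 (div_pos (hu0 _) hW0)).le, ?_⟩⟩
  · exact (((huc.comp hσc).div_const W).inv₀ fun t => (div_pos (hu0 _) hW0).ne').continuousOn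
  · have h3 := huI _ (hmaps ht)
    change (u (e.symm t) / W)⁻¹ * w (e.symm t) ≤ _
    rw [← hW, inv_div, div_mul_eq_mul_div, div_le_iff₀ (hu0 _)]
    gcongr
    linarith

variable {E : Type*} [NormedAddCommGroup E] [NormedSpace ℝ E]
  {G : E → E →L[ℝ] E →L[ℝ] ℝ} {γ v : ℝ → E}

theorem IsC1Curve.comp {σ σ' : ℝ → ℝ} (hγ : IsC1Curve γ v) (hσ : IsC1Curve σ σ')
    (hmaps : MapsTo σ (Icc 0 1) (Icc 0 1)) :
    IsC1Curve (γ ∘ σ) (fun t => σ' t • v (σ t)) :=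
  ⟨fun t ht => (hγ.hasDerivWithinAt _ (hmaps ht)).scomp t (hσ.hasDerivWithinAt t ht) hmaps,
    hσ.continuousOn_velocity.smul (hγ.continuousOn_velocity.comp hσ.continuousOn hmaps)⟩

/-- The length of a curve `γ` with velocity `v` for the metric tensor `G`. -/
noncomputable def arcLength (G : E → E →L[ℝ] E →L[ℝ] ℝ) (γ v : ℝ → E) : ℝ :=
  ∫ t in (0 : ℝ)..1, √(G (γ t) (v t) (v t))

theorem arcLength_nonneg : 0 ≤ arcLength G γ v :=
  intervalIntegral.integral_nonneg zero_le_one fun _ _ => Real.sqrt_nonneg _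

theorem arcLength_sq_le_energy (hcont : ContinuousOn (fun t => G (γ t) (v t) (v t)) (Icc 0 1))
    (hpos : ∀ t ∈ Icc (0 : ℝ) 1, 0 ≤ G (γ t) (v t) (v t)) :
    arcLength G γ v ^ 2 ≤ energy G γ v := by
  have h := integral_mul_le_sqrt_mul_sqrt hcont.sqrt (continuousOn_const (c := (1 : ℝ)))
  have e : ∫ t in (0 : ℝ)..1, √(G (γ t) (v t) (v t)) ^ 2 = energy G γ v :=
    intervalIntegral.integral_congr fun t ht =>
      Real.sq_sqrt (hpos t (by rwa [uIcc_of_le zero_le_one] at ht))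
  have h0 : 0 ≤ energy G γ v := intervalIntegral.integral_nonneg zero_le_one hpos
  simp only [mul_one, one_pow, intervalIntegral.integral_const, sub_zero, one_smul,
    Real.sqrt_one, e] at h
  calc arcLength G γ v ^ 2 ≤ √(energy G γ v) ^ 2 :=
        pow_le_pow_left₀ arcLength_nonneg h 2
    _ = _ := Real.sq_sqrt h0

/-- A curve has reparametrizations whose speed exceeds the length by arbitrarily little, at every
time; in particular the energy is then not much more than the square of the length. -/
theorem IsC1Curve.exists_reparametrization (hγ : IsC1Curve γ v)
    (hcont : ContinuousOn (fun t => G (γ t) (v t) (v t)) (Icc 0 1))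
    (hpos : ∀ t ∈ Icc (0 : ℝ) 1, 0 ≤ G (γ t) (v t) (v t)) {η : ℝ} (hη : 0 < η) :
    ∃ γ' v' : ℝ → E, IsC1Curve γ' v' ∧ γ' 0 = γ 0 ∧ γ' 1 = γ 1 ∧
      (∀ t ∈ Icc (0 : ℝ) 1, γ' t ∈ γ '' Icc 0 1) ∧
      ∀ t ∈ Icc (0 : ℝ) 1, G (γ' t) (v' t) (v' t) ≤ (arcLength G γ v + η) ^ 2 := by
  obtain ⟨σ, σ', hσ, h0, h1, hmaps, hle⟩ := exists_reparametrization_mul_le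
    (w := fun t => √(G (γ t) (v t) (v t))) hcont.sqrt (fun t _ => Real.sqrt_nonneg _) hη
  refine ⟨γ ∘ σ, fun t => σ' t • v (σ t), hγ.comp hσ hmaps, by simp [h0], by simp [h1],
    fun t ht => mem_image_of_mem γ (hmaps ht), fun t ht => ?_⟩
  obtain ⟨hσ0, hσle⟩ := hle t ht
  have e : G ((γ ∘ σ) t) (σ' t • v (σ t)) (σ' t • v (σ t)) =
      (σ' t * √(G (γ (σ t)) (v (σ t)) (v (σ t)))) ^ 2 := by
    rw [mul_pow, Real.sq_sqrt (hpos _ (hmaps ht))]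
    simp only [Function.comp_apply, map_smul, smul_apply, smul_eq_mul]
    ring
  rw [e]
  exact pow_le_pow_left₀ (mul_nonneg hσ0 (Real.sqrt_nonneg _)) hσle 2

theorem IsC1Curve.contDiffOn {γ v : ℝ → E} (hγ : IsC1Curve γ v) : ContDiffOn ℝ 1 γ (Icc 0 1) := by
  have hu := uniqueDiffOn_Icc (zero_lt_one' ℝ)
  rw [contDiffOn_one_iff_derivWithin hu]
  refine ⟨fun t ht => (hγ.hasDerivWithinAt t ht).differentiableWithinAt, ?_⟩
  exact hγ.continuousOn_velocity.congr fun t ht => (hγ.hasDerivWithinAt t ht).derivWithin (hu t ht)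

theorem IsC1Curve.of_contDiffOn {γ : ℝ → E} (hγ : ContDiffOn ℝ 1 γ (Icc 0 1)) :
    IsC1Curve γ (derivWithin γ (Icc 0 1)) := by
  have h := (contDiffOn_one_iff_derivWithin (uniqueDiffOn_Icc (zero_lt_one' ℝ))).1 hγ
  exact ⟨fun t ht => (h.1 t ht).hasDerivWithinAt, h.2⟩

end Reparametrization

/-! ### The Riemannian distance in a chart -/

section RiemannianChart

open Set MeasureTheory Filter Topology

variable {E : Type*} [NormedAddCommGroup E] [NormedSpace ℝ E]
  {M : Type*} [MetricSpace M] [ChartedSpace E M]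

theorem mfderiv_extChartAt_symm_eq_symmL [IsManifold 𝓘(ℝ, E) ∞ M] (x₀ : M) {y : E}
    (hy : y ∈ (extChartAt 𝓘(ℝ, E) x₀).target) (v : E) :
    mfderiv 𝓘(ℝ, E) 𝓘(ℝ, E) (extChartAt 𝓘(ℝ, E) x₀).symm y v =
      (trivializationAt E (TangentSpace 𝓘(ℝ, E) : M → Type _) x₀).symmL ℝ
        ((extChartAt 𝓘(ℝ, E) x₀).symm y) v := by
  set φ := extChartAt 𝓘(ℝ, E) x₀ with hφ
  have hy' : φ.symm y ∈ (chartAt E x₀).source := by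
    have := φ.map_target hy
    rwa [hφ, extChartAt_source] at this
  have h := TangentBundle.symmL_trivializationAt (I := 𝓘(ℝ, E)) (x₀ := x₀) hy'
  rw [modelWithCornersSelf_coe, range_id, mfderivWithin_univ] at h
  let D : E → E →L[ℝ] E := fun z => mfderiv 𝓘(ℝ, E) 𝓘(ℝ, E) φ.symm z
  have h' : D (φ (φ.symm y)) = D y := congrArg D (φ.right_inv hy)
  exact (congrArg (fun L : E →L[ℝ] E => L v) (h.trans h')).symm

variable [Bundle.RiemannianBundle (fun x : M => TangentSpace 𝓘(ℝ, E) x)]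

/-- `G` is the metric tensor of `M`, read in the preferred chart at `x₀`. -/
def IsMetricInChart (x₀ : M) (G : E → E →L[ℝ] E →L[ℝ] ℝ) : Prop :=
  ∀ y ∈ (extChartAt 𝓘(ℝ, E) x₀).target, ∀ v w : E, G y v w =
    inner ℝ (mfderiv 𝓘(ℝ, E) 𝓘(ℝ, E) (extChartAt 𝓘(ℝ, E) x₀).symm y v)
      (mfderiv 𝓘(ℝ, E) 𝓘(ℝ, E) (extChartAt 𝓘(ℝ, E) x₀).symm y w)

/-- A smooth Riemannian metric has a smooth expression in a chart, namely its expression in the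
trivialization of the tangent bundle given by that chart. -/
theorem exists_isMetricInChart [IsManifold 𝓘(ℝ, E) ∞ M]
    [IsContMDiffRiemannianBundle 𝓘(ℝ, E) ∞ E (fun x : M => TangentSpace 𝓘(ℝ, E) x)] (x₀ : M) :
    ∃ G : E → E →L[ℝ] E →L[ℝ] ℝ, ContDiffAt ℝ 2 G (extChartAt 𝓘(ℝ, E) x₀ x₀) ∧
      IsMetricInChart x₀ G := by
  obtain ⟨g, hg, hgi⟩ := IsContMDiffRiemannianBundle.exists_contMDiff (IB := 𝓘(ℝ, E)) (n := 2)
    (F := E) (E := fun x : M => TangentSpace 𝓘(ℝ, E) x)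
  set φ := extChartAt 𝓘(ℝ, E) x₀ with hφ
  have h1 := ((contMDiffAt_hom_bundle _).1 (hg x₀)).2
  have h2 : ContMDiffAt 𝓘(ℝ, E) 𝓘(ℝ, E) 2 φ.symm (φ x₀) :=
    (contMDiffOn_extChartAt_symm x₀).contMDiffAt (extChartAt_target_mem_nhds x₀)
  have h3 : φ.symm (φ x₀) = x₀ := extChartAt_to_inv x₀
  have h4 := ContMDiffAt.comp (φ x₀) (by rw [h3]; exact h1) h2
  refine ⟨_, contMDiffAt_iff_contDiffAt.1 h4, fun y hy v w => ?_⟩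
  have hy' : φ.symm y ∈ (chartAt E x₀).source := by
    have := φ.map_target hy
    rwa [hφ, extChartAt_source] at this
  rw [mfderiv_extChartAt_symm_eq_symmL x₀ hy, mfderiv_extChartAt_symm_eq_symmL x₀ hy, hgi]
  simp only [Function.comp_apply]
  rw [inCoordinates_apply_eq₂ hy' hy' (mem_univ _)]
  rw [Bundle.Trivialization.symmL_apply _ hy', Bundle.Trivialization.symmL_apply _ hy']
  simp only [Bundle.Trivial.fiberBundle_trivializationAt', Bundle.Trivial.linearMapAt_trivialization,
    LinearMap.id_coe, id_eq]
  rfl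

/-- The metric tensor is uniformly positive definite near the center of a chart, because the
trivialization of the tangent bundle is locally bounded. -/
theorem IsMetricInChart.exists_eventually_le [IsManifold 𝓘(ℝ, E) ∞ M]
    [IsContMDiffRiemannianBundle 𝓘(ℝ, E) ∞ E (fun x : M => TangentSpace 𝓘(ℝ, E) x)] {x₀ : M}
    {G : E → E →L[ℝ] E →L[ℝ] ℝ} (hGM : IsMetricInChart x₀ G) :
    ∃ c > 0, ∀ᶠ y in 𝓝 (extChartAt 𝓘(ℝ, E) x₀ x₀), ∀ u : E, c * ‖u‖ ^ 2 ≤ G y u u := by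
  obtain ⟨g, hg, hgi⟩ := IsContMDiffRiemannianBundle.exists_contMDiff (IB := 𝓘(ℝ, E)) (n := ∞)
    (F := E) (E := fun x : M => TangentSpace 𝓘(ℝ, E) x)
  have : IsContinuousRiemannianBundle E (fun x : M => TangentSpace 𝓘(ℝ, E) x) :=
    ⟨g, hg.continuous, hgi⟩
  obtain ⟨C, hC, h⟩ := eventually_norm_trivializationAt_lt E
    (fun x : M => TangentSpace 𝓘(ℝ, E) x) x₀
  set φ := extChartAt 𝓘(ℝ, E) x₀ with hφ
  have h3 : φ.symm (φ x₀) = x₀ := extChartAt_to_inv x₀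
  have h2 : ContinuousAt φ.symm (φ x₀) := continuousAt_extChartAt_symm x₀
  refine ⟨(C ^ 2)⁻¹, by positivity, ?_⟩
  filter_upwards [h2.eventually (by rw [h3]; exact h), extChartAt_target_mem_nhds x₀]
    with y hy hyt u
  have hy' : φ.symm y ∈ (chartAt E x₀).source := by
    have := φ.map_target hyt
    rwa [hφ, extChartAt_source] at this
  rw [hGM y hyt, mfderiv_extChartAt_symm_eq_symmL x₀ hyt, real_inner_self_eq_norm_sq]
  set e := trivializationAt E (TangentSpace 𝓘(ℝ, E) : M → Type _) x₀ with he
  have h5 : e.continuousLinearMapAt ℝ (φ.symm y) (e.symmL ℝ (φ.symm y) u) = u :=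
    e.continuousLinearMapAt_symmL hy' u
  have h6 : ‖u‖ ≤ C * ‖e.symmL ℝ (φ.symm y) u‖ := by
    conv_lhs => rw [← h5]
    exact (ContinuousLinearMap.le_opNorm _ _).trans (by gcongr)
  rw [inv_mul_le_iff₀ (by positivity), ← mul_pow]
  gcongr

namespace IsMetricInChart

variable {x₀ : M} {G : E → E →L[ℝ] E →L[ℝ] ℝ} {γ v : ℝ → E}

theorem symm (hGM : IsMetricInChart x₀ G) {y : E} (hy : y ∈ (extChartAt 𝓘(ℝ, E) x₀).target)
    (v w : E) : G y v w = G y w v := by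
  rw [hGM y hy, hGM y hy, real_inner_comm]

theorem nonneg (hGM : IsMetricInChart x₀ G) {y : E} (hy : y ∈ (extChartAt 𝓘(ℝ, E) x₀).target)
    (v : E) : 0 ≤ G y v v := by
  rw [hGM y hy]
  exact real_inner_self_nonneg

variable [IsManifold 𝓘(ℝ, E) ∞ M]

theorem enorm_mfderivWithin_eq (hGM : IsMetricInChart x₀ G) (hγ : IsC1Curve γ v)
    (hγt : ∀ t ∈ Icc (0 : ℝ) 1, γ t ∈ (extChartAt 𝓘(ℝ, E) x₀).target) {t : ℝ}
    (ht : t ∈ Icc (0 : ℝ) 1) :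
    ‖mfderivWithin 𝓘(ℝ, ℝ) 𝓘(ℝ, E) ((extChartAt 𝓘(ℝ, E) x₀).symm ∘ γ) (Icc 0 1) t (1 : ℝ)‖ₑ =
      ENNReal.ofReal √(G (γ t) (v t) (v t)) := by
  have hu : UniqueMDiffWithinAt 𝓘(ℝ, ℝ) (Icc (0 : ℝ) 1) t :=
    (uniqueDiffOn_Icc zero_lt_one t ht).uniqueMDiffWithinAt
  have h1 : MDifferentiableAt 𝓘(ℝ, E) 𝓘(ℝ, E) (extChartAt 𝓘(ℝ, E) x₀).symm (γ t) :=
    ((contMDiffOn_extChartAt_symm (n := 1) x₀).contMDiffAt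
      (extChartAt_target_mem_nhds' (hγt t ht))).mdifferentiableAt one_ne_zero
  have h2 := hγ.hasDerivWithinAt t ht
  have h3 : MDifferentiableWithinAt 𝓘(ℝ, ℝ) 𝓘(ℝ, E) γ (Icc 0 1) t :=
    h2.differentiableWithinAt.mdifferentiableWithinAt
  rw [mfderiv_comp_mfderivWithin t h1 h3 hu, mfderivWithin_eq_fderivWithin]
  have h4 : fderivWithin ℝ γ (Icc 0 1) t (1 : ℝ) = v t := by
    rw [fderivWithin_derivWithin, h2.derivWithin (uniqueDiffOn_Icc zero_lt_one t ht)]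
  rw [hGM _ (hγt t ht), ← norm_eq_sqrt_real_inner, ofReal_norm, ← h4]
  rfl

theorem pathELength_eq (hGM : IsMetricInChart x₀ G) (hγ : IsC1Curve γ v)
    (hγt : ∀ t ∈ Icc (0 : ℝ) 1, γ t ∈ (extChartAt 𝓘(ℝ, E) x₀).target)
    (hcont : ContinuousOn (fun t => G (γ t) (v t) (v t)) (Icc 0 1)) :
    Manifold.pathELength 𝓘(ℝ, E) ((extChartAt 𝓘(ℝ, E) x₀).symm ∘ γ) 0 1 =
      ENNReal.ofReal (arcLength G γ v) := by
  rw [Manifold.pathELength_eq_lintegral_mfderivWithin_Icc, arcLength,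
    intervalIntegral.integral_of_le zero_le_one, ← integral_Icc_eq_integral_Ioc,
    ofReal_integral_eq_lintegral_ofReal (hcont.sqrt.integrableOn_Icc)
      (Eventually.of_forall fun t => Real.sqrt_nonneg _)]
  exact setLIntegral_congr_fun measurableSet_Icc fun t ht =>
    hGM.enorm_mfderivWithin_eq hγ hγt ht

variable [IsRiemannianManifold 𝓘(ℝ, E) M]

theorem dist_sq_le_energy (hGM : IsMetricInChart x₀ G) (hγ : IsC1Curve γ v)
    (hγt : ∀ t ∈ Icc (0 : ℝ) 1, γ t ∈ (extChartAt 𝓘(ℝ, E) x₀).target)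
    (hcont : ContinuousOn (fun t => G (γ t) (v t) (v t)) (Icc 0 1)) :
    dist ((extChartAt 𝓘(ℝ, E) x₀).symm (γ 0)) ((extChartAt 𝓘(ℝ, E) x₀).symm (γ 1)) ^ 2 ≤
      energy G γ v := by
  refine le_trans ?_ (arcLength_sq_le_energy hcont fun t ht => hGM.nonneg (hγt t ht) _)
  have hsm : ContMDiffOn 𝓘(ℝ, ℝ) 𝓘(ℝ, E) 1 ((extChartAt 𝓘(ℝ, E) x₀).symm ∘ γ) (Icc 0 1) :=
    (contMDiffOn_extChartAt_symm (n := 1) x₀).comp (contMDiffOn_iff_contDiffOn.2 hγ.contDiffOn) hγt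
  have h := Manifold.riemannianEDist_le_pathELength hsm rfl rfl zero_le_one
  rw [← IsRiemannianManifold.out, hGM.pathELength_eq hγ hγt hcont, edist_dist,
    ENNReal.ofReal_le_ofReal_iff arcLength_nonneg] at h
  exact pow_le_pow_left₀ dist_nonneg h 2

/-- Near minimizers exist: a path in `M` which is almost as short as possible stays near `x₀`, hence
in the domain of the chart, and can be reparametrized with almost constant speed. -/
theorem exists_isNearMinimizer (hGM : IsMetricInChart x₀ G)
    (hG : ContDiffAt ℝ 2 G (extChartAt 𝓘(ℝ, E) x₀ x₀)) {c : ℝ} (hc₀ : 0 < c)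
    (hc : ∀ᶠ y in 𝓝 (extChartAt 𝓘(ℝ, E) x₀ x₀), ∀ u : E, c * ‖u‖ ^ 2 ≤ G y u u)
    {ρ : ℝ} (hρ : 0 < ρ) :
    ∃ δ > 0, ∀ a ∈ Metric.ball (extChartAt 𝓘(ℝ, E) x₀ x₀) δ,
      ∀ b ∈ Metric.ball (extChartAt 𝓘(ℝ, E) x₀ x₀) δ, ∀ η > 0, ∃ γ v : ℝ → E,
        IsNearMinimizer G (fun a b => dist ((extChartAt 𝓘(ℝ, E) x₀).symm a)
          ((extChartAt 𝓘(ℝ, E) x₀).symm b) ^ 2) (extChartAt 𝓘(ℝ, E) x₀ x₀) ρ η a b γ v := by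
  set φ := extChartAt 𝓘(ℝ, E) x₀ with hφ
  obtain ⟨r, hr, hball⟩ := Metric.mem_nhds_iff.1 (inter_mem (inter_mem
    (extChartAt_target_mem_nhds (I := 𝓘(ℝ, E)) x₀) hc) (hG.eventually (by simp)))
  have hGc : ContinuousOn G (Metric.ball (φ x₀) r) := fun y hy => by
    have hy' : ContDiffAt ℝ 2 G y := (hball hy).2
    exact hy'.continuousAt.continuousWithinAt
  obtain ⟨R, hR, hRball⟩ := Metric.mem_nhds_iff.1 (inter_mem
    (extChartAt_source_mem_nhds (I := 𝓘(ℝ, E)) x₀)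
    ((continuousAt_extChartAt (I := 𝓘(ℝ, E)) x₀).preimage_mem_nhds
      (Metric.ball_mem_nhds (φ x₀) (lt_min hρ hr))))
  -- paths shorter than `3 τ` from the `τ`-ball at `x₀` do not leave the `R`-ball, where the chart is
  -- under control; the second bound makes speeds below `4 τ` for `G` at most `ρ` in norm
  set τ := min (R / 4) (√c * ρ / 4) with hτ
  have hτ0 : 0 < τ := by positivity
  have hτR : τ ≤ R / 4 := min_le_left _ _
  have hτρ : τ ≤ √c * ρ / 4 := min_le_right _ _
  have hsymm : ContinuousAt φ.symm (φ x₀) := continuousAt_extChartAt_symm x₀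
  have hx₀ : φ.symm (φ x₀) = x₀ := extChartAt_to_inv x₀
  obtain ⟨δ, hδ, hδball⟩ := Metric.mem_nhds_iff.1 (inter_mem
    (extChartAt_target_mem_nhds (I := 𝓘(ℝ, E)) x₀)
    (hsymm.preimage_mem_nhds (by rw [hx₀]; exact Metric.ball_mem_nhds x₀ hτ0)))
  refine ⟨δ, hδ, fun a ha b hb η hη => ?_⟩
  obtain ⟨hat, haτ⟩ := hδball ha
  obtain ⟨hbt, hbτ⟩ := hδball hb
  have haτ' : dist (φ.symm a) x₀ < τ := haτ
  have hbτ' : dist (φ.symm b) x₀ < τ := hbτ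
  set D := dist (φ.symm a) (φ.symm b) with hD
  have hD0 : 0 ≤ D := dist_nonneg
  have hDτ : D < 2 * τ := by
    have := dist_triangle_right (φ.symm a) (φ.symm b) x₀
    linarith
  -- one `ζ` is lost in the choice of the path and another one in its reparametrization
  set ζ := min τ (η / (12 * τ)) with hζ
  have hζ0 : 0 < ζ := by positivity
  have hζτ : ζ ≤ τ := min_le_left _ _
  have hζη : (D + 2 * ζ) ^ 2 ≤ D ^ 2 + η := by
    have h1 : ζ ≤ η / (12 * τ) := min_le_right _ _
    rw [le_div_iff₀ (by positivity)] at h1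
    have h2 : ζ * (D + ζ) ≤ ζ * (3 * τ) := by gcongr; linarith
    linarith
  have hlt : Manifold.riemannianEDist 𝓘(ℝ, E) (φ.symm a) (φ.symm b) < ENNReal.ofReal (D + ζ) := by
    rw [← IsRiemannianManifold.out, edist_dist, ENNReal.ofReal_lt_ofReal_iff (by linarith)]
    linarith
  obtain ⟨α, hα0, hα1, hαC, hαlen⟩ := Manifold.exists_lt_of_riemannianEDist_lt hlt
  have hαR : ∀ t ∈ Icc (0 : ℝ) 1, α t ∈ Metric.ball x₀ R := by
    intro t ht
    have h1 : Manifold.riemannianEDist 𝓘(ℝ, E) (φ.symm a) (α t) < ENNReal.ofReal (D + ζ) :=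
      ((Manifold.riemannianEDist_le_pathELength (hαC.mono (Icc_subset_Icc le_rfl ht.2)) hα0 rfl
        ht.1).trans (Manifold.pathELength_mono le_rfl ht.2)).trans_lt hαlen
    rw [← IsRiemannianManifold.out, edist_dist, ENNReal.ofReal_lt_ofReal_iff (by linarith)] at h1
    have h2 := dist_triangle_left (α t) x₀ (φ.symm a)
    rw [Metric.mem_ball]
    linarith
  have hγC : ContDiffOn ℝ 1 (φ ∘ α) (Icc 0 1) := by
    rw [← contMDiffOn_iff_contDiffOn]
    refine (contMDiffOn_extChartAt (I := 𝓘(ℝ, E)) (n := 1) (x := x₀)).comp hαC fun t ht => ?_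
    have := (hRball (hαR t ht)).1
    rwa [extChartAt_source] at this
  have hγ := IsC1Curve.of_contDiffOn hγC
  set v := derivWithin (φ ∘ α) (Icc 0 1) with hv
  have hγball : ∀ t ∈ Icc (0 : ℝ) 1, (φ ∘ α) t ∈ Metric.ball (φ x₀) (min ρ r) :=
    fun t ht => (hRball (hαR t ht)).2
  have hγr : ∀ t ∈ Icc (0 : ℝ) 1, (φ ∘ α) t ∈ Metric.ball (φ x₀) r :=
    fun t ht => Metric.ball_subset_ball (min_le_right _ _) (hγball t ht)
  have hγt : ∀ t ∈ Icc (0 : ℝ) 1, (φ ∘ α) t ∈ φ.target := fun t ht => (hball (hγr t ht)).1.1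
  have hcont := continuousOn_energy_integrand hGc hγ hγr
  have hlen : arcLength G (φ ∘ α) v < D + ζ := by
    have h1 := hGM.pathELength_eq hγ hγt hcont
    have h2 : Manifold.pathELength 𝓘(ℝ, E) (φ.symm ∘ (φ ∘ α)) 0 1 =
        Manifold.pathELength 𝓘(ℝ, E) α 0 1 :=
      Manifold.pathELength_congr fun t ht => φ.left_inv (hRball (hαR t ht)).1
    rwa [← h2, h1, ENNReal.ofReal_lt_ofReal_iff (by linarith)] at hαlen
  have hlen0 : 0 ≤ arcLength G (φ ∘ α) v := arcLength_nonneg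
  obtain ⟨γ', v', hγ', h0, h1, him, hspeed⟩ := hγ.exists_reparametrization hcont
    (fun t ht => hGM.nonneg (hγt t ht) _) hζ0
  have hγ'ball : ∀ t ∈ Icc (0 : ℝ) 1, γ' t ∈ Metric.ball (φ x₀) (min ρ r) := by
    intro t ht
    obtain ⟨s, hs, hs'⟩ := him t ht
    rw [← hs']
    exact hγball s hs
  have hγ'r : ∀ t ∈ Icc (0 : ℝ) 1, γ' t ∈ Metric.ball (φ x₀) r :=
    fun t ht => Metric.ball_subset_ball (min_le_right _ _) (hγ'ball t ht)
  have hspeed' : ∀ t ∈ Icc (0 : ℝ) 1, G (γ' t) (v' t) (v' t) ≤ (D + 2 * ζ) ^ 2 := fun t ht =>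
    (hspeed t ht).trans (pow_le_pow_left₀ (by linarith) (by linarith) 2)
  refine ⟨γ', v', hγ', ?_, ?_, fun t ht => Metric.ball_subset_ball (min_le_left _ _) (hγ'ball t ht),
    fun t ht => ?_, ?_⟩
  · rw [h0, Function.comp_apply, hα0, φ.right_inv hat]
  · rw [h1, Function.comp_apply, hα1, φ.right_inv hbt]
  · have h2 : c * ‖v' t‖ ^ 2 ≤ c * ρ ^ 2 :=
      calc c * ‖v' t‖ ^ 2 ≤ (D + 2 * ζ) ^ 2 :=
            ((hball (hγ'r t ht)).1.2 (v' t)).trans (hspeed' t ht)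
        _ ≤ (√c * ρ) ^ 2 := pow_le_pow_left₀ (by linarith) (by linarith) 2
        _ = c * ρ ^ 2 := by rw [mul_pow, Real.sq_sqrt hc₀.le]
    exact (sq_le_sq₀ (norm_nonneg _) hρ.le).1 (le_of_mul_le_mul_left h2 hc₀)
  · calc energy G γ' v' ≤ ∫ t in (0 : ℝ)..1, (D + 2 * ζ) ^ 2 :=
          intervalIntegral.integral_mono_on zero_le_one
            ((continuousOn_energy_integrand hGc hγ' hγ'r).intervalIntegrable_of_Icc zero_le_one)
            intervalIntegrable_const hspeed'
      _ = (D + 2 * ζ) ^ 2 := by simp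
      _ ≤ D ^ 2 + η := hζη

end IsMetricInChart

end RiemannianChart

/-! ### Double differences of the squared distance -/

section RiemannianDist

open Set Filter Topology

variable {E : Type*} [NormedAddCommGroup E] [NormedSpace ℝ E] [CompleteSpace E]
  {M : Type*} [MetricSpace M] [ChartedSpace E M] [IsManifold 𝓘(ℝ, E) ∞ M]
  [Bundle.RiemannianBundle (fun x : M => TangentSpace 𝓘(ℝ, E) x)]
  [IsContMDiffRiemannianBundle 𝓘(ℝ, E) ∞ E (fun x : M => TangentSpace 𝓘(ℝ, E) x)]
  [IsRiemannianManifold 𝓘(ℝ, E) M]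

/-- To leading order near a point, the double difference of the squared Riemannian distance is that
of the squared norm of an inner product `B` on the chart. -/
theorem exists_nhds_doubleDifference_dist_sq_le (x₀ : M) :
    ∃ B : E →L[ℝ] E →L[ℝ] ℝ, (∃ c > 0, ∀ u, c * ‖u‖ ^ 2 ≤ B u u) ∧
      ∀ ε > 0, ∃ U ∈ 𝓝 x₀, ∀ z ∈ U, ∀ z' ∈ U, ∀ p ∈ U, ∀ p' ∈ U,
        dist z' p' ^ 2 + dist z p ^ 2 - dist z' p ^ 2 - dist z p' ^ 2 ≤
          -2 * B (extChartAt 𝓘(ℝ, E) x₀ z' - extChartAt 𝓘(ℝ, E) x₀ z)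
            (extChartAt 𝓘(ℝ, E) x₀ p' - extChartAt 𝓘(ℝ, E) x₀ p)
          + ε * (‖extChartAt 𝓘(ℝ, E) x₀ z' - extChartAt 𝓘(ℝ, E) x₀ z‖ *
            ‖extChartAt 𝓘(ℝ, E) x₀ p' - extChartAt 𝓘(ℝ, E) x₀ p‖) := by
  set φ := extChartAt 𝓘(ℝ, E) x₀ with hφ
  obtain ⟨G, hG, hGM⟩ := exists_isMetricInChart (E := E) x₀
  obtain ⟨c, hc₀, hc⟩ := hGM.exists_eventually_le
  have ht : φ.target ∈ 𝓝 (φ x₀) := extChartAt_target_mem_nhds x₀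
  refine ⟨G (φ x₀), ⟨c, hc₀, hc.self_of_nhds⟩, fun ε hε => ?_⟩
  obtain ⟨r, hr, hball⟩ := Metric.mem_nhds_iff.1 (inter_mem ht (hG.eventually (by simp)))
  have hGc : ContinuousOn G (Metric.ball (φ x₀) r) := fun y hy => by
    have hy' : ContDiffAt ℝ 2 G y := (hball hy).2
    exact hy'.continuousAt.continuousWithinAt
  obtain ⟨δ, hδ, H⟩ := exists_ball_doubleDifference_le hG
    (hGM.symm (mem_of_mem_nhds ht)) hc₀ hc.self_of_nhds
    ⟨r, hr, fun γ v hγ hγr => hGM.dist_sq_le_energy hγ (fun t ht' => (hball (hγr t ht')).1)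
      (continuousOn_energy_integrand hGc hγ hγr)⟩
    (fun ρ hρ => hGM.exists_isNearMinimizer hG hc₀ hc hρ) hε
  refine ⟨φ.source ∩ φ ⁻¹' Metric.ball (φ x₀) δ, inter_mem (extChartAt_source_mem_nhds x₀)
    ((continuousAt_extChartAt x₀).preimage_mem_nhds (Metric.ball_mem_nhds _ hδ)),
    fun z hz z' hz' p hp p' hp' => ?_⟩
  have := H (φ z) hz.2 (φ p) hp.2 (φ z') hz'.2 (φ p') hp'.2
  rwa [φ.left_inv hz.1, φ.left_inv hz'.1, φ.left_inv hp.1, φ.left_inv hp'.1] at this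

end RiemannianDist

/-! ### Flags of median hyperplanes -/

section MedianFlag

open Set Filter Topology

/-- Both points of the pair `b` are equidistant from the two points of the pair `a`. -/
def IsEquidistantPair {X : Type*} [MetricSpace X] (a b : X × X) : Prop :=
  dist b.1 a.1 = dist b.1 a.2 ∧ dist b.2 a.1 = dist b.2 a.2

/-- The pairs of distinct points in `S` fall into finitely many classes, none of which contains two
pairs `a`, `b` such that both points of `b` are equidistant from those of `a`. -/
def HasFiniteMedianCover {X : Type*} [MetricSpace X] (S : Set (X × X)) : Prop :=
  ∃ 𝒞 : Set (Set (X × X)), 𝒞.Finite ∧ (∀ a ∈ S, a.1 ≠ a.2 → ∃ C ∈ 𝒞, a ∈ C) ∧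
    ∀ C ∈ 𝒞, ∀ a ∈ C, ∀ b ∈ C, ¬ IsEquidistantPair a b

namespace HasFiniteMedianCover

variable {X : Type*} [MetricSpace X] {S T : Set (X × X)}

theorem empty : HasFiniteMedianCover (∅ : Set (X × X)) :=
  ⟨∅, finite_empty, by simp, by simp⟩

theorem mono (h : S ⊆ T) : HasFiniteMedianCover T → HasFiniteMedianCover S :=
  fun ⟨𝒞, hfin, hcov, hC⟩ => ⟨𝒞, hfin, fun a ha => hcov a (h ha), hC⟩

theorem union : HasFiniteMedianCover S → HasFiniteMedianCover T → HasFiniteMedianCover (S ∪ T) := by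
  rintro ⟨𝒞, hfin, hcov, hC⟩ ⟨𝒟, hfin', hcov', hD⟩
  refine ⟨𝒞 ∪ 𝒟, hfin.union hfin', fun a ha hne => ?_, fun C hC' => hC'.elim (hC C) (hD C)⟩
  rcases ha with ha | ha
  · obtain ⟨C, hC, haC⟩ := hcov a ha hne
    exact ⟨C, Or.inl hC, haC⟩
  · obtain ⟨C, hC, haC⟩ := hcov' a ha hne
    exact ⟨C, Or.inr hC, haC⟩

/-- By the pigeonhole principle, two pairs of a flag with more members than there are classes
would lie in the same class. -/
theorem exists_le_of_containsMedianFlag (h : HasFiniteMedianCover (univ : Set (X × X))) :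
    ∃ N : ℕ, ∀ n : ℕ, ContainsMedianFlag X n → n ≤ N := by
  obtain ⟨𝒞, hfin, hcov, hC⟩ := h
  refine ⟨𝒞.ncard, fun n ⟨p, q, hpq⟩ => ?_⟩
  choose F hF hmem using fun i => hcov (p i, q i) (mem_univ _) (hpq.ne i)
  have hlt : ∀ s i, s < i → F s ≠ F i := fun s i hsi heq =>
    hC _ (hF s) (p s, q s) (hmem s) (p i, q i) (heq ▸ hmem i)
      ⟨hpq.equidist_left s i hsi, hpq.equidist_right s i hsi⟩
  have hinj : Function.Injective F := fun s i heq => by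
    by_contra hne
    rcases lt_or_gt_of_ne hne with h | h
    · exact hlt _ _ h heq
    · exact hlt _ _ h heq.symm
  have := ncard_le_ncard (range_subset_iff.2 hF) hfin
  rwa [← image_univ, ncard_image_of_injective _ hinj, ncard_univ, Nat.card_fin] at this

/-- Away from the diagonal there is a neighborhood with a single class: for nearby pairs `a` and `b`,
the point `b.1` is close to `a.1` and far from `a.2`. -/
theorem exists_nhds_of_ne {x y : X} (hxy : x ≠ y) :
    ∃ W ∈ 𝓝 (x, y), HasFiniteMedianCover W := by
  have hd : 0 < dist x y := dist_pos.2 hxy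
  refine ⟨Metric.ball x (dist x y / 4) ×ˢ Metric.ball y (dist x y / 4),
    prod_mem_nhds (Metric.ball_mem_nhds _ (by positivity)) (Metric.ball_mem_nhds _ (by positivity)),
    {Metric.ball x (dist x y / 4) ×ˢ Metric.ball y (dist x y / 4)}, finite_singleton _,
    fun a ha _ => ⟨_, rfl, ha⟩, ?_⟩
  rintro C rfl a ⟨ha1, ha2⟩ b ⟨hb1, hb2⟩ ⟨h1, -⟩
  rw [Metric.mem_ball] at ha1 ha2 hb1
  have h3 := dist_triangle_right b.1 a.1 x
  rw [dist_comm] at hb1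
  have h5 : dist x y ≤ dist x b.1 + dist b.1 a.2 + dist a.2 y := dist_triangle4 _ _ _ _
  rw [dist_comm b.1 x] at h3
  linarith

/-- Near the diagonal, the pairs are classified by the approximate direction of their displacement
in a chart: the displacements of `a` and `b` are almost orthogonal if the points of `b` are
equidistant from those of `a`. -/
theorem exists_nhds_diagonal (E : Type*) [NormedAddCommGroup E] [NormedSpace ℝ E]
    [FiniteDimensional ℝ E] {M : Type*} [MetricSpace M] [ChartedSpace E M]
    [IsManifold 𝓘(ℝ, E) ∞ M] [Bundle.RiemannianBundle (fun x : M => TangentSpace 𝓘(ℝ, E) x)]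
    [IsContMDiffRiemannianBundle 𝓘(ℝ, E) ∞ E (fun x : M => TangentSpace 𝓘(ℝ, E) x)]
    [IsRiemannianManifold 𝓘(ℝ, E) M] (x₀ : M) :
    ∃ W ∈ 𝓝 (x₀, x₀), HasFiniteMedianCover W := by
  have : CompleteSpace E := FiniteDimensional.complete ℝ E
  have : ProperSpace E := FiniteDimensional.proper ℝ E
  set φ := extChartAt 𝓘(ℝ, E) x₀ with hφ
  obtain ⟨B, ⟨c, hc₀, hc⟩, H⟩ := exists_nhds_doubleDifference_dist_sq_le (E := E) x₀
  obtain ⟨U, hU, HU⟩ := H c hc₀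
  -- two unit vectors `e`, `e'` within `2 κ` of each other have `B e e' ≥ c - ‖B‖ * (2 κ) ≥ 3 c / 4`
  set κ := c / (8 * (‖B‖ + 1)) with hκ
  have hB : 0 < ‖B‖ + 1 := by positivity
  have hκ0 : 0 < κ := by positivity
  obtain ⟨t, -, htfin, htcov⟩ := (isCompact_sphere (0 : E) 1).finite_cover_balls hκ0
  set V := U ∩ φ.source with hV
  have hVx : V ∈ 𝓝 x₀ := inter_mem hU (extChartAt_source_mem_nhds x₀)
  -- the unit vector in the direction of the displacement of a pair
  set dir : M × M → E := fun a => ‖φ a.2 - φ a.1‖⁻¹ • (φ a.2 - φ a.1) with hdir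
  have hpos : ∀ a ∈ V ×ˢ V, a.1 ≠ a.2 → 0 < ‖φ a.2 - φ a.1‖ := fun a ha hne =>
    norm_pos_iff.2 (sub_ne_zero.2 fun h => hne (φ.injOn ha.1.2 ha.2.2 h.symm))
  have hunit : ∀ a ∈ V ×ˢ V, a.1 ≠ a.2 → ‖dir a‖ = 1 := fun a ha hne => by
    rw [hdir, norm_smul, norm_inv, norm_norm, inv_mul_cancel₀ (hpos a ha hne).ne']
  refine ⟨V ×ˢ V, prod_mem_nhds hVx hVx,
    (fun u => {a ∈ V ×ˢ V | a.1 ≠ a.2 ∧ dir a ∈ Metric.ball u κ}) '' t, htfin.image _,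
    fun a ha hne => ?_, ?_⟩
  · have := htcov (mem_sphere_zero_iff_norm.2 (hunit a ha hne))
    simp only [mem_iUnion, exists_prop] at this
    obtain ⟨u, hu, hau⟩ := this
    exact ⟨_, mem_image_of_mem _ hu, ha, hne, hau⟩
  · rintro _ ⟨u, -, rfl⟩ a ⟨ha, hane, hau⟩ b ⟨hb, hbne, hbu⟩ ⟨h1, h2⟩
    -- the four squared distances cancel, and only `2 B(displacements) ≤ c ‖·‖ ‖·‖` is left
    have key := HU b.1 hb.1.1 b.2 hb.2.1 a.1 ha.1.1 a.2 ha.2.1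
    rw [h1, h2, add_sub_right_comm, sub_self, zero_add, sub_self] at key
    have ha0 := hpos a ha hane
    have hb0 := hpos b hb hbne
    have eB : B (φ b.2 - φ b.1) (φ a.2 - φ a.1) =
        B (dir b) (dir a) * (‖φ b.2 - φ b.1‖ * ‖φ a.2 - φ a.1‖) := by
      simp only [hdir, map_smul, smul_apply, smul_eq_mul]
      field_simp
    rw [eB] at key
    have hle : 2 * B (dir b) (dir a) ≤ c := by
      refine le_of_mul_le_mul_right ?_ (mul_pos hb0 ha0)
      linarith
    have hclose : ‖dir b - dir a‖ ≤ 2 * κ := by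
      rw [← dist_eq_norm]
      have := dist_triangle_right (dir b) (dir a) u
      rw [Metric.mem_ball] at hau hbu
      linarith
    have hBκ : ‖B‖ * (2 * κ) ≤ c / 4 := by
      have : (‖B‖ + 1) * (2 * κ) = c / 4 := by
        rw [hκ]
        field_simp
        ring
      rw [← this]
      gcongr
      linarith
    have hdiff : B (dir b) (dir b - dir a) ≤ c / 4 := by
      have h3 := (le_abs_self _).trans (B.le_opNorm₂ (dir b) (dir b - dir a))
      rw [hunit b hb hbne, mul_one] at h3
      exact (h3.trans (by gcongr)).trans hBκ
    have hcb := hc (dir b)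
    rw [hunit b hb hbne, one_pow, mul_one] at hcb
    rw [map_sub] at hdiff
    linarith

end HasFiniteMedianCover

end MedianFlag

theorem mainTheorem1 (m : ℕ) {M : Type*} [MetricSpace M]
    [ChartedSpace (EuclideanSpace ℝ (Fin m)) M] [IsManifold (𝓡 m) ∞ M]
    [Bundle.RiemannianBundle (fun x : M => TangentSpace (𝓡 m) x)]
    [IsContMDiffRiemannianBundle (𝓡 m) ∞ (EuclideanSpace ℝ (Fin m))
      (fun x : M => TangentSpace (𝓡 m) x)]
    [IsRiemannianManifold (𝓡 m) M] [CompactSpace M] [ConnectedSpace M] :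
    ∃ N : ℕ, ∀ n : ℕ, ContainsMedianFlag M n → n ≤ N := by
  refine HasFiniteMedianCover.exists_le_of_containsMedianFlag ?_
  refine isCompact_univ.induction_on HasFiniteMedianCover.empty
    (fun S T h => HasFiniteMedianCover.mono h) (fun S T => HasFiniteMedianCover.union) ?_
  rintro ⟨x, y⟩ -
  rw [nhdsWithin_univ]
  by_cases hxy : x = y
  · subst hxy
    exact HasFiniteMedianCover.exists_nhds_diagonal (EuclideanSpace ℝ (Fin m)) x
  · exact HasFiniteMedianCover.exists_nhds_of_ne hxy
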